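/- Let $N\ge 3$, $k\in\mathbb N$, $h_1,\dots,h_k\in C^1(\mathbb S^{N-1})$, let $a_1,\dots,a_k\in\mathbb R^N$ be pairwise distinct, and put $2^*=\frac{2N}{N-2}$. Let $\mathcal D^{1,2}(\mathbb R^N)$ be the closure of $C_c^\infty(\mathbb R^N)$ with respect to the norm $\|u\|_{\mathcal D^{1,2}}=\big(\int_{\mathbb R^N}|\nabla u|^2\,dx\big)^{1/2}$ (a subspace of $L^{2^*}(\mathbb R^N)$), and for $h\in C^1(\mathbb S^{N-1})$ let $$\mu_1(h)=\inf_{\psi\in H^1(\mathbb S^{N-1})\setminus\{0\}}\frac{\int_{\mathbb S^{N-1}}|\nabla_{\mathbb S^{N-1}}\psi|^2\,dV-\int_{\mathbb S^{N-1}}h\,\psi^2\,dV}{\int_{\mathbb S^{N-1}}\psi^2\,dV}$$ be the first eigenvalue of $-\Delta_{\mathbb S^{N-1}}-h$ on $\mathbb S^{N-1}$. Assume that $$\mu_1(h_i)>-\Big(\frac{N-2}2\Big)^2\ \text{ for all } i=1,\dots,k,\qquad \mu_1\Big(\sum_{i=1}^k h_i\Big)>-\Big(\frac{N-2}2\Big)^2,$$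 and that there is $v\in\mathcal D^{1,2}(\mathbb R^N)$ with $v>0$ a.e. that solves, weakly, $$-\Delta v-\sum_{i=1}^k\frac{h_i\big(\frac{x-a_i}{|x-a_i|}\big)}{|x-a_i|^2}\,v=v^{2^*-1}\quad\text{in }\mathbb R^N\setminus\{a_1,\dots,a_k\},$$ that is, for every $\varphi\in C_c^\infty(\mathbb R^N\setminus\{a_1,\dots,a_k\})$, $$\int_{\mathbb R^N}\nabla v\cdot\nabla\varphi\,dx-\sum_{i=1}^k\int_{\mathbb R^N}\frac{h_i\big(\frac{x-a_i}{|x-a_i|}\big)}{|x-a_i|^2}\,v\,\varphi\,dx=\int_{\mathbb R^N}v^{2^*-1}\varphi\,dx.$$ Then the quadratic form $$\mathcal Q(u)=\int_{\mathbb R^N}|\nabla u|^2\,dx-\sum_{i=1}^k\int_{\mathbb R^N}\frac{h_i\big(\frac{x-a_i}{|x-a_i|}\big)}{|x-a_i|^2}\,u^2\,dx$$ is positive definite on $\mathcal D^{1,2}(\mathbb R^N)$, i.e. $$\mu(h_1,\dots,h_k,a_1,\dots,a_k):=\inf_{u\in\mathcal D^{1,2}(\mathbb R^N)\setminus\{0\}}\frac{\mathcal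 Q(u)}{\|u\|_{\mathcal D^{1,2}}^2}>0.$$ -/

import Mathlib

open MeasureTheory Filter Topology Metric
open scoped ContDiff Manifold RealInnerProductSpace

/-- Euclidean space `ℝ^N`. -/
abbrev RN (N : ℕ) : Type := EuclideanSpace ℝ (Fin N)

/-- The unit sphere `𝕊^{N-1}` of `ℝ^N`. -/
abbrev Sph (N : ℕ) : Type := sphere (0 : RN N) 1

instance factFinrankRN (N : ℕ) [hN : Fact (3 ≤ N)] :
    Fact (Module.finrank ℝ (RN N) = (N - 1) + 1) :=
  ⟨by have := hN.out; simp; omega⟩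

/-- The surface measure on `𝕊^{N-1}`. -/
noncomputable def surfaceMeasure (N : ℕ) : Measure (Sph N) :=
  (volume : Measure (RN N)).toSphere

/-- `f ∈ C^r(𝕊^{N-1})`, for the standard smooth structure of the sphere. -/
def SphereContDiff {N : ℕ} [Fact (3 ≤ N)] (r : ℕ∞) (f : Sph N → ℝ) : Prop :=
  ContMDiff (𝓡 (N - 1)) 𝓘(ℝ, ℝ) r f

open Classical in
/-- The function `x ↦ f (x / |x|)` on `ℝ^N \ {0}` (with the value `0` at the origin). -/
noncomputable def angular {N : ℕ} (f : Sph N → ℝ) (x : RN N) : ℝ :=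
  if hx : x = 0 then 0
  else f ⟨‖x‖⁻¹ • x, by simp [norm_smul, hx]⟩

/-- The gradient on the sphere of a smooth function, as a vector field along the sphere with
values in `ℝ^N`: it is the Euclidean gradient of the `0`-homogeneous extension. -/
noncomputable def sphereGrad {N : ℕ} (f : Sph N → ℝ) (θ : Sph N) : RN N :=
  gradient (angular f) (θ : RN N)

/-- `ψ ∈ H¹(𝕊^{N-1})` with gradient `G`: the pair `(ψ, G)` is in the `L² × L²` closure of the
pairs `(f, ∇f)`, `f ∈ C^∞(𝕊^{N-1})`. -/
def HasH1SphereGrad {N : ℕ} [Fact (3 ≤ N)] (ψ : Sph N → ℝ) (G : Sph N → RN N) : Prop :=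
  MemLp ψ 2 (surfaceMeasure N) ∧ MemLp G 2 (surfaceMeasure N) ∧
  ∃ f : ℕ → Sph N → ℝ, (∀ n, SphereContDiff ⊤ (f n)) ∧
    Tendsto (fun n => eLpNorm (f n - ψ) 2 (surfaceMeasure N)) atTop (𝓝 0) ∧
    Tendsto (fun n => eLpNorm (sphereGrad (f n) - G) 2 (surfaceMeasure N)) atTop (𝓝 0)

/-- `μ₁(h)`, the first eigenvalue of `-Δ - h` on `𝕊^{N-1}`, through its Rayleigh quotient. -/
noncomputable def sphereFirstEigenvalue {N : ℕ} [Fact (3 ≤ N)] (h : Sph N → ℝ) : ℝ :=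
  sInf {t : ℝ | ∃ (ψ : Sph N → ℝ) (G : Sph N → RN N),
    HasH1SphereGrad ψ G ∧ ¬ ψ =ᵐ[surfaceMeasure N] 0 ∧
    t = ((∫ θ, ‖G θ‖ ^ 2 ∂surfaceMeasure N) - ∫ θ, h θ * ψ θ ^ 2 ∂surfaceMeasure N) /
      ∫ θ, ψ θ ^ 2 ∂surfaceMeasure N}

/-- The critical Sobolev exponent `2^* = 2N / (N - 2)`. -/
noncomputable def critExp (N : ℕ) : ℝ := 2 * (N : ℝ) / ((N : ℝ) - 2)

/-- `u ∈ 𝒟^{1,2}(ℝ^N)` with gradient `G`, where `𝒟^{1,2}(ℝ^N)` is the closure of `C_c^∞(ℝ^N)` in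
the norm `‖∇u‖_{L²}`, realized as a space of functions in `L^{2^*}` by Sobolev's inequality. -/
def HasD12Grad {N : ℕ} (u : RN N → ℝ) (G : RN N → RN N) : Prop :=
  MemLp u (ENNReal.ofReal (critExp N)) ∧ MemLp G 2 ∧
  ∃ φ : ℕ → RN N → ℝ, (∀ n, ContDiff ℝ ∞ (φ n) ∧ HasCompactSupport (φ n)) ∧
    Tendsto (fun n => eLpNorm (φ n - u) (ENNReal.ofReal (critExp N))) atTop (𝓝 0) ∧
    Tendsto (fun n => eLpNorm (gradient (φ n) - G) 2) atTop (𝓝 0)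

/-- The potential `h((x - a)/|x - a|) / |x - a|²` with pole `a`. -/
noncomputable def polePotential {N : ℕ} (h : Sph N → ℝ) (a x : RN N) : ℝ :=
  angular h (x - a) / ‖x - a‖ ^ 2

/-- The quadratic form `𝒬(u) = ∫ |∇u|² - ∑ᵢ ∫ hᵢ((x - aᵢ)/|x - aᵢ|) / |x - aᵢ|² u²`, where `G`
is the gradient of `u`. -/
noncomputable def quadForm {N k : ℕ} (h : Fin k → Sph N → ℝ) (a : Fin k → RN N)
    (u : RN N → ℝ) (G : RN N → RN N) : ℝ :=
  (∫ x, ‖G x‖ ^ 2) - ∑ i, ∫ x, polePotential (h i) (a i) x * u x ^ 2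

/-- `μ(h₁,…,h_k,a₁,…,a_k)`, the infimum over `𝒟^{1,2}(ℝ^N) \ {0}` of `𝒬(u) / ‖∇u‖²`. -/
noncomputable def formInf {N k : ℕ} (h : Fin k → Sph N → ℝ) (a : Fin k → RN N) : ℝ :=
  sInf {t : ℝ | ∃ (u : RN N → ℝ) (G : RN N → RN N),
    HasD12Grad u G ∧ ¬ u =ᵐ[volume] 0 ∧ t = quadForm h a u G / ∫ x, ‖G x‖ ^ 2}

/-- `u` is a positive `𝒟^{1,2}(ℝ^N)`-solution of
`-Δu - ∑ᵢ hᵢ((x - aᵢ)/|x - aᵢ|) / |x - aᵢ|² u = u^{2^* - 1}` in `ℝ^N \ {a₁,…,a_k}`, in the weak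
sense. -/
def IsPositiveD12Solution {N k : ℕ} (h : Fin k → Sph N → ℝ) (a : Fin k → RN N)
    (u : RN N → ℝ) : Prop :=
  (∀ᵐ x, 0 < u x) ∧
  ∃ G : RN N → RN N, HasD12Grad u G ∧
    ∀ φ : RN N → ℝ, ContDiff ℝ ∞ φ → HasCompactSupport φ →
      Disjoint (tsupport φ) (Set.range a) →
      (∫ x, ⟪G x, gradient φ x⟫) - ∑ i, ∫ x, polePotential (h i) (a i) x * u x * φ x =
        ∫ x, u x ^ (critExp N - 1) * φ x

/-! A positive solution of a linear equation forces the quadratic form to be nonnegative. Here the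
nonlinear term makes the form quantitatively positive wherever `v` is not small, and the spectral
hypotheses handle the rest. Coercivity is first proved for test functions `φ` that vanish near the
poles. Write `V` for the total potential, `D = ∫ |∇φ|²` and `Q(φ) = D - ∫ V φ²`.

Spectral side. Split `∇φ` into its radial and tangential parts. The radial part controls `((N - 2) /
2)² ∫ φ² / |x|²` (`hardy_radial`), and on each sphere the tangential part is bounded below by the
Rayleigh quotient (`hardy_angular`). An eigenvalue above the threshold therefore gives coercivity
for a single pole, with room to spare (`exists_hardy_gap`). Seen from infinity, `V` is to leading
order one pole with profile `∑ hᵢ`. Cutting off around each pole and around infinity leaves only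
errors on a ball `K`, so `δ D ≤ Q(φ) + C ∫_K φ²` for some `δ > 0` (`form_bound_of_localization`,
`exists_localized_form_bound`).

Solution side. Testing the equation with `φ² / (v + ε)` and completing a square is Picone's argument
(`IsPositiveD12Solution.integral_le_of_pos`). Letting `ε → 0` and keeping the nonlinear term gives
`c ∫_S φ² ≤ Q(φ)` whenever `v ≥ η` on `S` (`IsPositiveD12Solution.exists_lower_bound`). Because `v >
0` a.e., the set `K ∩ {v < η}` has as small a measure as desired. On it, Sobolev's and Hölder's
inequalities absorb `C ∫ φ²` into `δ D / 2`, and on `K \ {v < η}` the solution bound applies.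
Together these yield `exists_coercive_test`.

Density. For `N ≥ 3` points have zero capacity, so functions vanishing near the poles are dense
(`HasD12Grad.exists_seq_test`). Hardy's inequality makes every potential term continuous under this
approximation (`tendsto_integral_polePotential`), so coercivity extends to the whole space. -/

/-- Smooth functions with compact support contained in the complement of `s`. -/
structure IsTestFunction {N : ℕ} (s : Set (RN N)) (φ : RN N → ℝ) : Prop where
  contDiff : ContDiff ℝ ∞ φ
  hasCompactSupport : HasCompactSupport φ
  disjoint : Disjoint (tsupport φ) s

/-! ### Calculus of Euclidean gradients -/

section Gradient

variable {N : ℕ} {f g : RN N → ℝ} {x : RN N}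

lemma norm_gradient_eq (f : RN N → ℝ) (x : RN N) : ‖gradient f x‖ = ‖fderiv ℝ f x‖ := by
  simp [gradient]

lemma continuous_gradient (hf : ContDiff ℝ 1 f) : Continuous (gradient f) :=
  (InnerProductSpace.toDual ℝ (RN N)).symm.continuous.comp (hf.continuous_fderiv one_ne_zero)

lemma tsupport_gradient_subset (f : RN N → ℝ) : tsupport (gradient f) ⊆ tsupport f := by
  refine closure_minimal (fun x hx => ?_) (isClosed_tsupport f)
  refine support_fderiv_subset ℝ (f := f) ?_
  intro h0
  exact hx (by simp [gradient, h0])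

lemma HasCompactSupport.gradient (hf : HasCompactSupport f) : HasCompactSupport (gradient f) :=
  hf.mono' ((subset_tsupport _).trans (tsupport_gradient_subset f))

lemma gradient_mul (hf : DifferentiableAt ℝ f x) (hg : DifferentiableAt ℝ g x) :
    gradient (fun y => f y * g y) x = f x • gradient g x + g x • gradient f x := by
  simp only [gradient]
  rw [fderiv_fun_mul hf hg]
  simp

lemma gradient_sub (hf : DifferentiableAt ℝ f x) (hg : DifferentiableAt ℝ g x) :
    gradient (fun y => f y - g y) x = gradient f x - gradient g x := by
  simp only [gradient]
  rw [fderiv_fun_sub hf hg]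
  simp

lemma gradient_scomp {F : ℝ → ℝ} (hF : DifferentiableAt ℝ F (f x)) (hf : DifferentiableAt ℝ f x) :
    gradient (fun y => F (f y)) x = deriv F (f x) • gradient f x := by
  simp only [gradient]
  have : fderiv ℝ (fun y => F (f y)) x = deriv F (f x) • fderiv ℝ f x :=
    (hF.hasDerivAt.comp_hasFDerivAt x hf.hasFDerivAt).fderiv
  rw [this]
  simp

lemma gradient_comp_add_right (f : RN N → ℝ) (a x : RN N) :
    gradient (fun y => f (y + a)) x = gradient f (x + a) := by
  simp only [gradient]
  rw [fderiv_comp_add_right]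

lemma memLp_gradient (hf : ContDiff ℝ 1 f) (hc : HasCompactSupport f) (p : ENNReal) :
    MemLp (gradient f) p :=
  (continuous_gradient hf).memLp_of_hasCompactSupport hc.gradient

lemma integrable_normSq_gradient (hf : ContDiff ℝ 1 f) (hc : HasCompactSupport f) :
    Integrable (fun x => ‖gradient f x‖ ^ 2) :=
  (memLp_gradient hf hc 2).integrable_norm_pow two_ne_zero

end Gradient

/-! ### Convergence of inner products and of bounded multipliers in `L²` -/

section Convergence

variable {α F : Type*} [MeasurableSpace α] {μ : Measure α} [NormedAddCommGroup F]
  [InnerProductSpace ℝ F]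

/-- Strong `L²` convergence of two sequences gives convergence of the inner products. -/
lemma tendsto_integral_inner_of_tendsto_eLpNorm {f g : ℕ → α → F} {f₀ g₀ : α → F}
    (hf : ∀ n, MemLp (f n) 2 μ) (hg : ∀ n, MemLp (g n) 2 μ) (hf₀ : MemLp f₀ 2 μ)
    (hg₀ : MemLp g₀ 2 μ) (hfl : Tendsto (fun n => eLpNorm (f n - f₀) 2 μ) atTop (𝓝 0))
    (hgl : Tendsto (fun n => eLpNorm (g n - g₀) 2 μ) atTop (𝓝 0)) :
    Tendsto (fun n => ∫ x, ⟪f n x, g n x⟫ ∂μ) atTop (𝓝 (∫ x, ⟪f₀ x, g₀ x⟫ ∂μ)) := by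
  have key : ∀ {u v : α → F} (hu : MemLp u 2 μ) (hv : MemLp v 2 μ),
      ⟪hu.toLp u, hv.toLp v⟫ = ∫ x, ⟪u x, v x⟫ ∂μ := by
    intro u v hu hv
    rw [L2.inner_def]
    refine integral_congr_ae ?_
    filter_upwards [hu.coeFn_toLp, hv.coeFn_toLp] with x h1 h2
    rw [h1, h2]
  have h1 := (Lp.tendsto_Lp_iff_tendsto_eLpNorm'' f hf f₀ hf₀).2 hfl
  have h2 := (Lp.tendsto_Lp_iff_tendsto_eLpNorm'' g hg g₀ hg₀).2 hgl
  have := h1.inner h2 (𝕜 := ℝ)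
  simpa only [key] using this

lemma MeasureTheory.MemLp.integrable_inner_two {u v : α → F} (hu : MemLp u 2 μ)
    (hv : MemLp v 2 μ) : Integrable (fun x => ⟪u x, v x⟫) μ := by
  refine (L2.integrable_inner (𝕜 := ℝ) (hu.toLp u) (hv.toLp v)).congr ?_
  filter_upwards [hu.coeFn_toLp, hv.coeFn_toLp] with x h1 h2
  rw [h1, h2]

lemma MeasureTheory.eLpNorm_sub_le_add {E : Type*} [NormedAddCommGroup E] {f g w : α → E}
    {p : ENNReal} (hf : AEStronglyMeasurable f μ) (hg : AEStronglyMeasurable g μ)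
    (hw : AEStronglyMeasurable w μ) (hp : 1 ≤ p) :
    eLpNorm (f - w) p μ ≤ eLpNorm (f - g) p μ + eLpNorm (g - w) p μ := by
  have h := eLpNorm_add_le (hf.sub hg) (hg.sub hw) hp
  rwa [sub_add_sub_cancel] at h

/-- Multiplication by bounded functions converging a.e. is continuous in `L²`. -/
lemma tendsto_eLpNorm_smul_sub {c : ℕ → α → ℝ} {c₀ : α → ℝ} {f : α → F} {C : ℝ}
    (hc : ∀ n, AEStronglyMeasurable (c n) μ) (hc₀ : AEStronglyMeasurable c₀ μ)
    (hb : ∀ n x, |c n x| ≤ C) (hl : ∀ᵐ x ∂μ, Tendsto (fun n => c n x) atTop (𝓝 (c₀ x)))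
    (hf : MemLp f 2 μ) :
    Tendsto (fun n => eLpNorm ((fun x => c n x • f x) - fun x => c₀ x • f x) 2 μ)
      atTop (𝓝 0) := by
  have hb₀ : ∀ᵐ x ∂μ, |c₀ x| ≤ C := by
    filter_upwards [hl] with x hx
    exact le_of_tendsto hx.abs (Eventually.of_forall fun n => hb n x)
  have hmeas : ∀ n, AEStronglyMeasurable
      ((fun x => c n x • f x) - fun x => c₀ x • f x) μ := fun n =>
    ((hc n).smul hf.1).sub (hc₀.smul hf.1)
  have hfin : ∫⁻ x, ‖(2 * C) • f x‖ₑ ^ (2 : ℝ) ∂μ ≠ ⊤ := by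
    have := (hf.const_smul (2 * C)).eLpNorm_lt_top
    have := lintegral_rpow_enorm_lt_top_of_eLpNorm_lt_top (by simp) (by simp) this
    simpa using this.ne
  have hlim := tendsto_lintegral_of_dominated_convergence'
    (F := fun n x => ‖c n x • f x - c₀ x • f x‖ₑ ^ (2 : ℝ)) (f := fun _ => 0)
    (fun x => ‖(2 * C) • f x‖ₑ ^ (2 : ℝ)) (fun n => ((hmeas n).enorm.pow_const _))
    (fun n => by
      filter_upwards [hb₀] with x hx
      refine ENNReal.rpow_le_rpow (enorm_le_iff_norm_le.2 ?_) (by norm_num)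
      have hC : 0 ≤ C := (abs_nonneg _).trans hx
      rw [← sub_smul, norm_smul, norm_smul, Real.norm_eq_abs, Real.norm_eq_abs,
        abs_of_nonneg (by positivity : (0 : ℝ) ≤ 2 * C)]
      gcongr
      exact (abs_sub _ _).trans (by linarith [hb n x])) hfin
    (by
      filter_upwards [hl] with x hx
      have h1 : Tendsto (fun n => c n x • f x - c₀ x • f x) atTop (𝓝 0) := by
        simpa using (hx.smul_const (f x)).sub_const (c₀ x • f x)
      have h2 := (ENNReal.continuous_rpow_const (y := (2 : ℝ))).tendsto 0
      simp only [ENNReal.zero_rpow_of_pos (by norm_num : (0 : ℝ) < 2)] at h2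
      refine h2.comp ?_
      simpa using h1.enorm)
  simp only [lintegral_zero] at hlim
  have h3 := (ENNReal.continuous_rpow_const (y := (1 / 2 : ℝ))).tendsto 0
  simp only [ENNReal.zero_rpow_of_pos (by norm_num : (0 : ℝ) < 1 / 2)] at h3
  refine (h3.comp hlim).congr fun n => ?_
  rw [eLpNorm_eq_lintegral_rpow_enorm_toReal (by simp) (by simp)]
  simp

end Convergence

/-! ### Inverse square potentials and integrability away from the pole -/

section Potential

variable {N : ℕ}

lemma angular_of_ne_zero (f : Sph N → ℝ) {x : RN N} (hx : x ≠ 0) :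
    angular f x = f ⟨‖x‖⁻¹ • x, by simp [norm_smul, hx]⟩ := by
  simp [angular, hx]

lemma angular_smul (f : Sph N → ℝ) {r : ℝ} (hr : 0 < r) (θ : Sph N) :
    angular f (r • (θ : RN N)) = f θ := by
  have hθ : ‖(θ : RN N)‖ = 1 := by simp
  have hne : r • (θ : RN N) ≠ 0 := by
    intro h0
    have := congrArg norm h0
    simp [norm_smul, hr.ne'] at this
  rw [angular_of_ne_zero f hne]
  congr 1
  ext1
  simp only [norm_smul, hθ, Real.norm_eq_abs, abs_of_pos hr, mul_one, smul_smul]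
  rw [inv_mul_cancel₀ hr.ne', one_smul]

lemma continuousOn_angular {f : Sph N → ℝ} (hf : Continuous f) :
    ContinuousOn (angular f) {0}ᶜ := by
  have hmem : ∀ x : ({0}ᶜ : Set (RN N)), ‖(x : RN N)‖⁻¹ • (x : RN N) ∈ sphere (0 : RN N) 1 := by
    intro x
    have := x.2
    simp only [Set.mem_compl_iff, Set.mem_singleton_iff] at this
    simp [norm_smul, this]
  have hcont : Continuous fun x : ({0}ᶜ : Set (RN N)) => ‖(x : RN N)‖⁻¹ • (x : RN N) := by
    have h1 : Continuous fun x : ({0}ᶜ : Set (RN N)) => ‖(x : RN N)‖ := by fun_prop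
    exact (h1.inv₀ fun x => norm_ne_zero_iff.2 x.2).smul continuous_subtype_val
  rw [continuousOn_iff_continuous_domRestrict]
  exact (hf.comp (hcont.subtype_mk hmem)).congr fun x => (angular_of_ne_zero f x.2).symm

lemma abs_angular_le {f : Sph N → ℝ} {M : ℝ} (hM : ∀ θ, |f θ| ≤ M) (hM0 : 0 ≤ M) (x : RN N) :
    |angular f x| ≤ M := by
  by_cases hx : x = 0
  · simp [angular, hx, hM0]
  · rw [angular_of_ne_zero f hx]
    exact hM _

lemma exists_abs_le_of_continuous {f : Sph N → ℝ} (hf : Continuous f) :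
    ∃ M, 0 ≤ M ∧ ∀ θ, |f θ| ≤ M := by
  obtain ⟨M, hM⟩ := isCompact_univ.exists_bound_of_continuousOn hf.continuousOn
  exact ⟨max M 0, le_max_right _ _, fun θ => (hM θ trivial).trans (le_max_left _ _)⟩

lemma continuousOn_polePotential {f : Sph N → ℝ} (hf : Continuous f) (a : RN N) :
    ContinuousOn (polePotential f a) {a}ᶜ := by
  have h1 : Set.MapsTo (fun x : RN N => x - a) {a}ᶜ {0}ᶜ := by
    intro x hx
    simpa [sub_eq_zero] using hx
  refine ContinuousOn.div ((continuousOn_angular hf).comp (by fun_prop) h1) (by fun_prop) ?_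
  intro x hx
  simpa [sub_eq_zero] using hx

lemma continuousOn_inv_normSq_sub (a : RN N) :
    ContinuousOn (fun x => (‖x - a‖ ^ 2)⁻¹) {a}ᶜ := by
  refine ContinuousOn.inv₀ (by fun_prop) ?_
  intro x hx
  simpa [sub_eq_zero] using hx

lemma abs_polePotential_le {f : Sph N → ℝ} {M : ℝ} (hM : ∀ θ, |f θ| ≤ M) (hM0 : 0 ≤ M)
    (a x : RN N) : |polePotential f a x| ≤ M * (‖x - a‖ ^ 2)⁻¹ := by
  rw [polePotential, abs_div, div_eq_mul_inv, abs_of_nonneg (by positivity : 0 ≤ ‖x - a‖ ^ 2)]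
  gcongr
  exact abs_angular_le hM hM0 _

/-- Near a point of `s` the factor `g` vanishes identically, so the singularity of `f` is never
seen. This is the source of the integrability of singular weights against test functions. -/
lemma continuous_mul_of_disjoint_tsupport {s : Set (RN N)} {f g : RN N → ℝ}
    (hs : IsClosed s) (hf : ContinuousOn f sᶜ) (hg : Continuous g)
    (hd : Disjoint (tsupport g) s) : Continuous (fun x => f x * g x) := by
  rw [continuous_iff_continuousAt]
  intro x
  by_cases hx : x ∈ s
  · have hx' : x ∉ tsupport g := fun h => Set.disjoint_left.1 hd h hx
    have h0 : (fun y => f y * g y) =ᶠ[𝓝 x] fun _ => 0 := by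
      filter_upwards [notMem_tsupport_iff_eventuallyEq.1 hx'] with y hy
      simp [hy]
    exact continuousAt_const.congr h0.symm
  · exact (hf.continuousAt (hs.isOpen_compl.mem_nhds hx)).mul hg.continuousAt

lemma integrable_mul_of_disjoint_tsupport {s : Set (RN N)} {f g : RN N → ℝ}
    (hs : IsClosed s) (hf : ContinuousOn f sᶜ) (hg : Continuous g) (hgc : HasCompactSupport g)
    (hd : Disjoint (tsupport g) s) : Integrable (fun x => f x * g x) :=
  (continuous_mul_of_disjoint_tsupport hs hf hg hd).integrable_of_hasCompactSupport hgc.mul_left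

lemma tsupport_sq (φ : RN N → ℝ) : tsupport (fun x => φ x ^ 2) = tsupport φ := by
  unfold tsupport
  congr 1
  ext x
  simp

lemma IsTestFunction.integrable_mul_sq {s : Set (RN N)} {φ f : RN N → ℝ}
    (hφ : IsTestFunction s φ) (hs : IsClosed s) (hf : ContinuousOn f sᶜ) :
    Integrable (fun x => f x * φ x ^ 2) := by
  refine integrable_mul_of_disjoint_tsupport hs hf (hφ.contDiff.continuous.pow 2) ?_ ?_
  · rw [HasCompactSupport, tsupport_sq]
    exact hφ.hasCompactSupport
  · rw [tsupport_sq]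
    exact hφ.disjoint

lemma IsTestFunction.mono {s t : Set (RN N)} {φ : RN N → ℝ} (hφ : IsTestFunction s φ)
    (hst : t ⊆ s) : IsTestFunction t φ :=
  ⟨hφ.contDiff, hφ.hasCompactSupport, hφ.disjoint.mono_right hst⟩

end Potential

/-! ### The radial Hardy inequality -/

section RadialHardy

variable {N : ℕ} {φ : RN N → ℝ}

lemma tsupport_inner_gradient_mul (φ : RN N → ℝ) :
    tsupport (fun x => φ x * ⟪gradient φ x, x⟫) ⊆ tsupport φ :=
  closure_mono fun x hx => by
    simp only [Function.mem_support, ne_eq, mul_eq_zero, not_or] at hx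
    exact hx.1

lemma tsupport_inner_gradient_sq (φ : RN N → ℝ) :
    tsupport (fun x => ⟪gradient φ x, x⟫ ^ 2) ⊆ tsupport φ := by
  refine Set.Subset.trans (closure_mono fun x hx => ?_) (tsupport_gradient_subset φ)
  intro h0
  refine hx ?_
  simp only [h0, inner_zero_left, ne_eq, OfNat.ofNat_ne_zero, not_false_eq_true, zero_pow]

lemma continuousOn_inv_normSq : ContinuousOn (fun x : RN N => (‖x‖ ^ 2)⁻¹) {0}ᶜ := by
  simpa using continuousOn_inv_normSq_sub (0 : RN N)

lemma IsTestFunction.integrable_radial (hφ : IsTestFunction {0} φ) :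
    Integrable (fun x => (‖x‖ ^ 2)⁻¹ * ⟪gradient φ x, x⟫ ^ 2) := by
  have hg : Continuous (gradient φ) := continuous_gradient (hφ.contDiff.of_le (by simp))
  refine integrable_mul_of_disjoint_tsupport isClosed_singleton continuousOn_inv_normSq
    ((hg.inner continuous_id).pow 2) ?_ (hφ.disjoint.mono_left (tsupport_inner_gradient_sq φ))
  exact hφ.hasCompactSupport.mono' ((subset_tsupport _).trans (tsupport_inner_gradient_sq φ))

lemma IsTestFunction.integrable_mixed (hφ : IsTestFunction {0} φ) :
    Integrable (fun x => (‖x‖ ^ 2)⁻¹ * (φ x * ⟪gradient φ x, x⟫)) := by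
  have hg : Continuous (gradient φ) := continuous_gradient (hφ.contDiff.of_le (by simp))
  refine integrable_mul_of_disjoint_tsupport isClosed_singleton continuousOn_inv_normSq
    (hφ.contDiff.continuous.mul (hg.inner continuous_id)) ?_
    (hφ.disjoint.mono_left (tsupport_inner_gradient_mul φ))
  exact hφ.hasCompactSupport.mono' ((subset_tsupport _).trans (tsupport_inner_gradient_mul φ))

/-- The divergence theorem for the vector field `φ² x / |x|²`. -/
lemma integral_mixed_eq (hφ : IsTestFunction {0} φ) :
    2 * ∫ x, (‖x‖ ^ 2)⁻¹ * (φ x * ⟪gradient φ x, x⟫) =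
      -((N : ℝ) - 2) * ∫ x, (‖x‖ ^ 2)⁻¹ * φ x ^ 2 := by
  have hdiff : Differentiable ℝ φ := hφ.contDiff.differentiable (by simp)
  have hfd : Continuous (fderiv ℝ φ) := hφ.contDiff.continuous_fderiv (by simp)
  have hsq : HasCompactSupport fun x => φ x ^ 2 := by
    rw [HasCompactSupport, tsupport_sq]
    exact hφ.hasCompactSupport
  have hsqd : Disjoint (tsupport fun x => φ x ^ 2) {0} := by
    rw [tsupport_sq]
    exact hφ.disjoint
  let e : Fin N → RN N := fun i => EuclideanSpace.single i 1
  have hinteg1 : ∀ i, Integrable (fun x : RN N =>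
      ((‖x‖ ^ 2)⁻¹ - 2 * x i ^ 2 * ((‖x‖ ^ 2)⁻¹) ^ 2) * φ x ^ 2) := fun i =>
    integrable_mul_of_disjoint_tsupport isClosed_singleton
      (continuousOn_inv_normSq.sub (ContinuousOn.mul (by fun_prop) (continuousOn_inv_normSq.pow 2)))
      (hφ.contDiff.continuous.pow 2) hsq hsqd
  have hsub : ∀ i, tsupport (fun x => 2 * φ x * fderiv ℝ φ x (e i)) ⊆ tsupport φ := fun i =>
    closure_mono fun x hx h0 => hx (by simp [h0])
  have hinteg2 : ∀ i, Integrable (fun x : RN N =>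
      (x i * (‖x‖ ^ 2)⁻¹) * (2 * φ x * fderiv ℝ φ x (e i))) := fun i =>
    integrable_mul_of_disjoint_tsupport isClosed_singleton
      (ContinuousOn.mul (by fun_prop) continuousOn_inv_normSq)
      ((hφ.contDiff.continuous.const_mul 2).mul (hfd.clm_apply continuous_const))
      (hφ.hasCompactSupport.mono' ((subset_tsupport _).trans (hsub i)))
      (hφ.disjoint.mono_left (hsub i))
  -- Integration by parts in each coordinate separately. The field `xᵢ / |x|²` is singular at the
  -- origin, but its derivative is needed only on the support of `φ²`, which avoids the origin.
  have hparts : ∀ i, ∫ x : RN N, (x i * (‖x‖ ^ 2)⁻¹) * (2 * φ x * fderiv ℝ φ x (e i)) =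
      - ∫ x : RN N, ((‖x‖ ^ 2)⁻¹ - 2 * x i ^ 2 * ((‖x‖ ^ 2)⁻¹) ^ 2) * φ x ^ 2 := by
    intro i
    refine integral_bilinear_hasLineDerivAt_right_eq_neg_left_of_integrable
      (B := ContinuousLinearMap.mul ℝ ℝ) (v := e i) (f := fun x : RN N => x i * (‖x‖ ^ 2)⁻¹)
      (g := fun x => φ x ^ 2) (hinteg1 i) (hinteg2 i) ?_ ?_ ?_
    · exact integrable_mul_of_disjoint_tsupport isClosed_singleton
        (ContinuousOn.mul (by fun_prop) continuousOn_inv_normSq)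
        (hφ.contDiff.continuous.pow 2) hsq hsqd
    · intro x hx
      have hx0 : x ≠ 0 := fun h => Set.disjoint_left.1 hsqd hx h
      have h1 : HasFDerivAt (fun y : RN N => y i) (EuclideanSpace.proj i : RN N →L[ℝ] ℝ) x :=
        (EuclideanSpace.proj i : RN N →L[ℝ] ℝ).hasFDerivAt
      have h2 : HasFDerivAt (fun y : RN N => ‖y‖ ^ 2) (2 • innerSL ℝ x) x :=
        (hasStrictFDerivAt_norm_sq x).hasFDerivAt
      have h3 := h1.mul ((hasDerivAt_inv (by positivity)).comp_hasFDerivAt x h2)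
      have heq : (‖x‖ ^ 2)⁻¹ - 2 * x i ^ 2 * ((‖x‖ ^ 2)⁻¹) ^ 2 =
          x i * (-((‖x‖ ^ 2) ^ 2)⁻¹ * (2 * ⟪x, e i⟫)) + (‖x‖ ^ 2)⁻¹ * (e i) i := by
        simp only [e, EuclideanSpace.inner_single_right, conj_trivial, PiLp.single_apply, if_true]
        field_simp
        ring
      have h4 := h3.hasLineDerivAt (e i)
      simp only [add_apply, smul_apply, smul_eq_mul, Function.comp_apply,
        innerSL_apply_apply, nsmul_eq_mul, Nat.cast_ofNat, PiLp.proj_apply] at h4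
      rw [heq]
      exact h4
    · intro x _
      have h4 := ((hdiff x).hasFDerivAt.pow 2).hasLineDerivAt (e i)
      convert h4 using 1
      simp
  have hexp : ∀ x : RN N, fderiv ℝ φ x x = ∑ i, x i * fderiv ℝ φ x (e i) := by
    intro x
    have : x = ∑ i, x i • e i := by
      have := (EuclideanSpace.basisFun (Fin N) ℝ).sum_repr x
      simpa [e] using this.symm
    conv_lhs => enter [2]; rw [this]
    simp only [map_sum, map_smul, smul_eq_mul]
  rw [← integral_const_mul, ← integral_const_mul]
  have hL : ∀ x : RN N, 2 * ((‖x‖ ^ 2)⁻¹ * (φ x * ⟪gradient φ x, x⟫)) =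
      ∑ i, (x i * (‖x‖ ^ 2)⁻¹) * (2 * φ x * fderiv ℝ φ x (e i)) := by
    intro x
    rw [inner_gradient_left, hexp, Finset.mul_sum, Finset.mul_sum, Finset.mul_sum]
    refine Finset.sum_congr rfl fun i _ => ?_
    ring
  have hR : ∀ x : RN N, -((N : ℝ) - 2) * ((‖x‖ ^ 2)⁻¹ * φ x ^ 2) =
      ∑ i, -(((‖x‖ ^ 2)⁻¹ - 2 * x i ^ 2 * ((‖x‖ ^ 2)⁻¹) ^ 2) * φ x ^ 2) := by
    intro x
    have hn : ∑ i, x i ^ 2 = ‖x‖ ^ 2 := by simp [EuclideanSpace.norm_sq_eq]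
    rw [Finset.sum_neg_distrib, ← Finset.sum_mul, Finset.sum_sub_distrib, ← Finset.sum_mul,
      ← Finset.mul_sum, hn]
    by_cases hx : x = 0
    · simp [hx]
    · have hx' : ‖x‖ ≠ 0 := by simpa using hx
      simp only [Finset.sum_const, Finset.card_univ, Fintype.card_fin, nsmul_eq_mul]
      field_simp
  simp_rw [hL, hR]
  rw [integral_finsetSum _ fun i _ => hinteg2 i, integral_finsetSum _ fun i _ => (by exact (hinteg1 i).neg)]
  refine Finset.sum_congr rfl fun i _ => ?_
  rw [hparts, integral_neg]

/-- The radial Hardy inequality. -/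
lemma hardy_radial (hφ : IsTestFunction {0} φ) :
    (((N : ℝ) - 2) / 2) ^ 2 * ∫ x, (‖x‖ ^ 2)⁻¹ * φ x ^ 2 ≤
      ∫ x, (‖x‖ ^ 2)⁻¹ * ⟪gradient φ x, x⟫ ^ 2 := by
  set c : ℝ := ((N : ℝ) - 2) / 2 with hc
  have hH : Integrable (fun x => (‖x‖ ^ 2)⁻¹ * φ x ^ 2) :=
    hφ.integrable_mul_sq isClosed_singleton continuousOn_inv_normSq
  -- Expansion of `|x|⁻² (⟨∇φ, x⟩ + c φ)² ≥ 0`. By the divergence identity the cross term integrates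
  -- to `-2c²` times the Hardy integral, leaving `-c²` in total.
  have h0 : 0 ≤ ∫ x, ((‖x‖ ^ 2)⁻¹ * ⟪gradient φ x, x⟫ ^ 2 +
      2 * c * ((‖x‖ ^ 2)⁻¹ * (φ x * ⟪gradient φ x, x⟫)) + c ^ 2 * ((‖x‖ ^ 2)⁻¹ * φ x ^ 2)) := by
    refine integral_nonneg fun x => ?_
    have : 0 ≤ (‖x‖ ^ 2)⁻¹ * (⟪gradient φ x, x⟫ + c * φ x) ^ 2 := by positivity
    refine this.trans_eq ?_
    ring
  rw [integral_add (by exact hφ.integrable_radial.add (hφ.integrable_mixed.const_mul _))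
    (hH.const_mul _), integral_add hφ.integrable_radial (hφ.integrable_mixed.const_mul _),
    integral_const_mul, integral_const_mul] at h0
  have h1 := integral_mixed_eq hφ
  rw [show -((N : ℝ) - 2) = -(2 * c) by rw [hc]; ring] at h1
  have h2 := congrArg (fun t => c * t) h1
  linarith

end RadialHardy

/-! ### Spherical gradients and the first eigenvalue -/

section Sphere

variable {N : ℕ}

instance isFiniteMeasure_surfaceMeasure (N : ℕ) : IsFiniteMeasure (surfaceMeasure N) := by
  unfold surfaceMeasure
  infer_instance

lemma Continuous.memLp_sphere {F : Type*} [NormedAddCommGroup F] [SecondCountableTopology F]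
    {f : Sph N → F} (hf : Continuous f) (p : ENNReal) : MemLp f p (surfaceMeasure N) :=
  hf.memLp_of_hasCompactSupport (HasCompactSupport.of_compactSpace f)

lemma integrable_sphere {f : Sph N → ℝ} (hf : Continuous f) : Integrable f (surfaceMeasure N) :=
  hf.integrable_of_hasCompactSupport (HasCompactSupport.of_compactSpace f)

lemma hasFDerivAt_norm_of_norm_eq_one {θ : RN N} (hθ : ‖θ‖ = 1) :
    HasFDerivAt (fun x : RN N => ‖x‖) (innerSL ℝ θ) θ := by
  have h := (hasStrictFDerivAt_norm_sq θ).hasFDerivAt.sqrt (by simp [hθ])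
  simp only [Real.sqrt_sq (norm_nonneg _)] at h
  refine h.congr_fderiv ?_
  ext v
  simp [hθ]

/-- The spherical gradient of `θ ↦ φ (r θ)` is `r` times the tangential part of `∇φ (r θ)`. -/
lemma sphereGrad_comp_smul {φ : RN N → ℝ} (hφ : Differentiable ℝ φ) (r : ℝ) (θ : Sph N) :
    sphereGrad (fun θ : Sph N => φ (r • (θ : RN N))) θ =
      r • (gradient φ (r • (θ : RN N)) -
        ⟪gradient φ (r • (θ : RN N)), (θ : RN N)⟫ • (θ : RN N)) := by
  have hθ : ‖(θ : RN N)‖ = 1 := by simp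
  have hθ0 : (θ : RN N) ≠ 0 := norm_ne_zero_iff.1 (by simp)
  have hev : angular (fun θ : Sph N => φ (r • (θ : RN N))) =ᶠ[𝓝 (θ : RN N)]
      fun x => φ (r • (‖x‖⁻¹ • x)) := by
    filter_upwards [isOpen_ne.mem_nhds hθ0] with x hx
    rw [angular_of_ne_zero _ hx]
  have h1 : HasFDerivAt (fun x : RN N => ‖x‖⁻¹) (-innerSL ℝ (θ : RN N)) (θ : RN N) := by
    refine ((hasDerivAt_inv (by simp)).comp_hasFDerivAt _
      (hasFDerivAt_norm_of_norm_eq_one hθ)).congr_fderiv ?_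
    ext v
    simp
  have h2 : HasFDerivAt (fun x : RN N => r • (‖x‖⁻¹ • x))
      (r • (ContinuousLinearMap.id ℝ (RN N) - (innerSL ℝ (θ : RN N)).smulRight (θ : RN N)))
      (θ : RN N) := by
    refine ((h1.smul (hasFDerivAt_id _)).const_smul r).congr_fderiv ?_
    ext v
    simp
    ring
  have h3 : HasFDerivAt φ (fderiv ℝ φ (r • (θ : RN N))) (r • (‖(θ : RN N)‖⁻¹ • (θ : RN N))) := by
    rw [hθ, inv_one, one_smul]
    exact (hφ _).hasFDerivAt
  have h4 := h3.comp (θ : RN N) h2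
  refine ext_inner_right ℝ fun v => ?_
  rw [sphereGrad, hev.gradient_eq, inner_gradient_left, inner_smul_left, inner_sub_left,
    inner_smul_left, inner_gradient_left, inner_gradient_left]
  have h5 : fderiv ℝ (fun x : RN N => φ (r • (‖x‖⁻¹ • x))) (θ : RN N) = _ := h4.fderiv
  rw [h5]
  simp only [ContinuousLinearMap.comp_apply, smul_apply, sub_apply,
    ContinuousLinearMap.id_apply, ContinuousLinearMap.smulRight_apply, innerSL_apply_apply, map_smul,
    map_sub, smul_eq_mul, conj_trivial]
  ring

lemma norm_sub_inner_smul_sq {w θ : RN N} (hθ : ‖θ‖ = 1) :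
    ‖w - ⟪w, θ⟫ • θ‖ ^ 2 = ‖w‖ ^ 2 - ⟪w, θ⟫ ^ 2 := by
  rw [norm_sub_sq_real, inner_smul_right, norm_smul, hθ]
  simp only [Real.norm_eq_abs, mul_one, sq_abs]
  ring

lemma IsTestFunction.translate {φ : RN N → ℝ} {a : RN N} (hφ : IsTestFunction {a} φ) :
    IsTestFunction {0} (fun x => φ (x + a)) := by
  refine ⟨hφ.contDiff.comp (contDiff_id.add contDiff_const),
    hφ.hasCompactSupport.comp_homeomorph (Homeomorph.addRight a), ?_⟩
  rw [Set.disjoint_singleton_right, notMem_tsupport_iff_eventuallyEq]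
  have h1 : a ∉ tsupport φ := Set.disjoint_singleton_right.1 hφ.disjoint
  rw [notMem_tsupport_iff_eventuallyEq] at h1
  have h2 : Tendsto (fun x : RN N => x + a) (𝓝 0) (𝓝 a) := by
    simpa using (continuous_add_const a).tendsto (0 : RN N)
  exact h2.eventually h1

lemma nontrivial_RN (N : ℕ) [hN : Fact (3 ≤ N)] : Nontrivial (RN N) :=
  haveI : Nonempty (Fin N) := ⟨⟨0, by have := hN.out; omega⟩⟩
  inferInstance

variable [Fact (3 ≤ N)]

lemma sphereContDiff_comp_smul {φ : RN N → ℝ} (hφ : ContDiff ℝ ∞ φ) (r : ℝ) :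
    SphereContDiff ⊤ (fun θ : Sph N => φ (r • (θ : RN N))) := by
  have h1 : ContDiff ℝ ∞ (fun x : RN N => φ (r • x)) := hφ.comp (contDiff_id.const_smul r)
  exact h1.contMDiff.comp (contMDiff_coe_sphere (m := ∞))

/-- The real `sInf` bounds the quotients from below only when their set is bounded below. A bound
for `|h|` provides this, since the gradient term is nonnegative. -/
lemma bddBelow_rayleigh {h : Sph N → ℝ} (hh : Continuous h) :
    BddBelow {t : ℝ | ∃ (ψ : Sph N → ℝ) (G : Sph N → RN N),
      HasH1SphereGrad ψ G ∧ ¬ ψ =ᵐ[surfaceMeasure N] 0 ∧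
      t = ((∫ θ, ‖G θ‖ ^ 2 ∂surfaceMeasure N) - ∫ θ, h θ * ψ θ ^ 2 ∂surfaceMeasure N) /
        ∫ θ, ψ θ ^ 2 ∂surfaceMeasure N} := by
  obtain ⟨M, hM0, hM⟩ := exists_abs_le_of_continuous hh
  refine ⟨-M, ?_⟩
  rintro t ⟨ψ, G, hψG, hne, rfl⟩
  have hinteg : Integrable (fun θ => ψ θ ^ 2) (surfaceMeasure N) := hψG.1.integrable_sq
  have hpos : 0 < ∫ θ, ψ θ ^ 2 ∂surfaceMeasure N := by
    refine lt_of_le_of_ne (integral_nonneg fun θ => sq_nonneg _) fun h0 => hne ?_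
    rw [eq_comm, integral_eq_zero_iff_of_nonneg (fun θ => sq_nonneg _) hinteg] at h0
    filter_upwards [h0] with θ hθ
    simpa using hθ
  rw [le_div_iff₀ hpos]
  have h1 : ∫ θ, h θ * ψ θ ^ 2 ∂surfaceMeasure N ≤ ∫ θ, M * ψ θ ^ 2 ∂surfaceMeasure N := by
    refine integral_mono (hinteg.bdd_mul hh.aestronglyMeasurable (c := M) (.of_forall hM))
      (hinteg.const_mul _) fun θ => ?_
    exact mul_le_mul_of_nonneg_right ((le_abs_self _).trans (hM θ)) (sq_nonneg _)
  rw [integral_const_mul] at h1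
  have h2 : 0 ≤ ∫ θ, ‖G θ‖ ^ 2 ∂surfaceMeasure N := integral_nonneg fun θ => sq_nonneg _
  linarith

/-- The first eigenvalue bounds the Rayleigh quotient of a smooth function. -/
lemma sphereFirstEigenvalue_mul_le {h ψ : Sph N → ℝ} (hh : Continuous h)
    (hψ : SphereContDiff ⊤ ψ) (hg : Continuous (sphereGrad ψ)) :
    sphereFirstEigenvalue h * ∫ θ, ψ θ ^ 2 ∂surfaceMeasure N ≤
      (∫ θ, ‖sphereGrad ψ θ‖ ^ 2 ∂surfaceMeasure N) -
        ∫ θ, h θ * ψ θ ^ 2 ∂surfaceMeasure N := by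
  have hψc : Continuous ψ := hψ.continuous
  have h2 : 0 ≤ ∫ θ, ‖sphereGrad ψ θ‖ ^ 2 ∂surfaceMeasure N :=
    integral_nonneg fun θ => sq_nonneg _
  -- The zero function is excluded from the Rayleigh set, so it is treated separately.
  by_cases h0 : ψ =ᵐ[surfaceMeasure N] 0
  · have e1 : ∫ θ, ψ θ ^ 2 ∂surfaceMeasure N = 0 :=
      integral_eq_zero_of_ae (by filter_upwards [h0] with θ hθ; simp [hθ])
    have e2 : ∫ θ, h θ * ψ θ ^ 2 ∂surfaceMeasure N = 0 :=
      integral_eq_zero_of_ae (by filter_upwards [h0] with θ hθ; simp [hθ])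
    rw [e1, e2]
    simpa using h2
  · have hpos : 0 < ∫ θ, ψ θ ^ 2 ∂surfaceMeasure N := by
      refine lt_of_le_of_ne (integral_nonneg fun θ => sq_nonneg _) fun h3 => h0 ?_
      rw [eq_comm, integral_eq_zero_iff_of_nonneg (fun θ => sq_nonneg _)
        (integrable_sphere (hψc.pow 2))] at h3
      filter_upwards [h3] with θ hθ
      simpa using hθ
    rw [← le_div_iff₀ hpos]
    refine csInf_le (bddBelow_rayleigh hh) ⟨ψ, sphereGrad ψ, ⟨hψc.memLp_sphere 2,
      hg.memLp_sphere 2, fun _ => ψ, fun _ => hψ, ?_, ?_⟩, h0, rfl⟩ <;> simp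

end Sphere

/-! ### Polar coordinates and Hardy's inequality with an angular profile -/

section Polar

variable {N : ℕ} [Fact (3 ≤ N)]

/-- A function whose integral over every sphere centred at the origin is nonnegative has a
nonnegative integral. -/
lemma integral_nonneg_of_integral_sphere_nonneg {F : RN N → ℝ} (hF : Integrable F)
    (h : ∀ r : ℝ, 0 < r → 0 ≤ ∫ θ : Sph N, F (r • (θ : RN N)) ∂surfaceMeasure N) :
    0 ≤ ∫ x, F x := by
  have := nontrivial_RN N
  have hmp := (volume : Measure (RN N)).measurePreserving_homeomorphUnitSphereProd
  have hemb := (Homeomorph.measurableEmbedding (homeomorphUnitSphereProd (RN N)))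
  have hcomp : ∀ x : ({0}ᶜ : Set (RN N)), F x =
      (fun p : Sph N × Set.Ioi (0 : ℝ) => F ((p.2 : ℝ) • (p.1 : RN N)))
        (homeomorphUnitSphereProd (RN N) x) := by
    intro x
    have hx : ‖(x : RN N)‖ ≠ 0 := norm_ne_zero_iff.2 x.2
    simp only [homeomorphUnitSphereProd_apply_snd_coe, homeomorphUnitSphereProd_apply_fst_coe]
    rw [smul_smul, mul_inv_cancel₀ hx, one_smul]
  have hcompf : (fun x : ({0}ᶜ : Set (RN N)) => F x) =
      (fun p : Sph N × Set.Ioi (0 : ℝ) => F ((p.2 : ℝ) • (p.1 : RN N))) ∘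
        (homeomorphUnitSphereProd (RN N)) := funext hcomp
  have hinteg : Integrable (fun p : Sph N × Set.Ioi (0 : ℝ) => F ((p.2 : ℝ) • (p.1 : RN N)))
      ((volume : Measure (RN N)).toSphere.prod
        (.volumeIoiPow (Module.finrank ℝ (RN N) - 1))) := by
    rw [← hmp.integrable_comp_emb hemb, ← hcompf]
    have := hF.integrableOn (s := {0}ᶜ)
    rwa [integrableOn_iff_comap_subtypeVal (by measurability)] at this
  have hpolar : ∫ x, F x = ∫ p : Sph N × Set.Ioi (0 : ℝ), F ((p.2 : ℝ) • (p.1 : RN N))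
      ∂((volume : Measure (RN N)).toSphere.prod
        (.volumeIoiPow (Module.finrank ℝ (RN N) - 1))) := by
    rw [← hmp.integral_comp hemb]
    conv_lhs => rw [← restrict_compl_singleton (μ := volume) (0 : RN N)]
    rw [← integral_subtype_comap (measurableSet_singleton _).compl]
    exact integral_congr_ae (.of_forall hcomp)
  -- The Jacobian `r^(N-1)` is part of the radial measure, so only the sign of the inner integral
  -- matters.
  rw [hpolar, integral_prod_symm _ hinteg]
  exact integral_nonneg fun r => h r r.2

/-- The angular part of Hardy's inequality. -/
lemma hardy_angular {h : Sph N → ℝ} (hh : Continuous h) {φ : RN N → ℝ}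
    (hφ : IsTestFunction {0} φ) :
    sphereFirstEigenvalue h * (∫ x, (‖x‖ ^ 2)⁻¹ * φ x ^ 2) +
        (∫ x, polePotential h 0 x * φ x ^ 2) ≤
      (∫ x, ‖gradient φ x‖ ^ 2) - ∫ x, (‖x‖ ^ 2)⁻¹ * ⟪gradient φ x, x⟫ ^ 2 := by
  set m := sphereFirstEigenvalue h
  have hdiff : Differentiable ℝ φ := hφ.contDiff.differentiable (by simp)
  have hgc : Continuous (gradient φ) := continuous_gradient (hφ.contDiff.of_le (by simp))
  have hH : Integrable (fun x => (‖x‖ ^ 2)⁻¹ * φ x ^ 2) :=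
    hφ.integrable_mul_sq isClosed_singleton continuousOn_inv_normSq
  have hP : Integrable (fun x => polePotential h 0 x * φ x ^ 2) :=
    hφ.integrable_mul_sq isClosed_singleton (continuousOn_polePotential hh 0)
  have hD := integrable_normSq_gradient (hφ.contDiff.of_le (by simp)) hφ.hasCompactSupport
  have hR := hφ.integrable_radial
  rw [← integral_const_mul, ← integral_add (hH.const_mul m) hP, ← integral_sub hD hR, ← sub_nonneg,
    ← integral_sub (by exact hD.sub hR) (by exact (hH.const_mul m).add hP)]
  refine integral_nonneg_of_integral_sphere_nonneg
    ((hD.sub hR).sub ((hH.const_mul m).add hP)) fun r hr => ?_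
  set ψ : Sph N → ℝ := fun θ => φ (r • (θ : RN N)) with hψ
  have hgrad : sphereGrad ψ = fun θ : Sph N => r • (gradient φ (r • (θ : RN N)) -
      ⟪gradient φ (r • (θ : RN N)), (θ : RN N)⟫ • (θ : RN N)) :=
    funext fun θ => sphereGrad_comp_smul hdiff r θ
  have hgcr : Continuous fun θ : Sph N => gradient φ (r • (θ : RN N)) :=
    hgc.comp (continuous_subtype_val.const_smul r)
  have hψc : Continuous ψ := hφ.contDiff.continuous.comp (continuous_subtype_val.const_smul r)
  have hgradc : Continuous (sphereGrad ψ) := by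
    rw [hgrad]
    exact (hgcr.sub ((hgcr.inner (𝕜 := ℝ) continuous_subtype_val).smul continuous_subtype_val)).const_smul r
  have i1 : Integrable (fun θ => ‖sphereGrad ψ θ‖ ^ 2) (surfaceMeasure N) :=
    integrable_sphere (hgradc.norm.pow 2)
  have i2 : Integrable (fun θ => h θ * ψ θ ^ 2) (surfaceMeasure N) :=
    integrable_sphere (hh.mul (hψc.pow 2))
  have i3 : Integrable (fun θ => m * ψ θ ^ 2) (surfaceMeasure N) :=
    integrable_sphere (continuous_const.mul (hψc.pow 2))
  have hmain : m * ∫ θ, ψ θ ^ 2 ∂surfaceMeasure N ≤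
      (∫ θ, ‖sphereGrad ψ θ‖ ^ 2 ∂surfaceMeasure N) - ∫ θ, h θ * ψ θ ^ 2 ∂surfaceMeasure N :=
    sphereFirstEigenvalue_mul_le hh (sphereContDiff_comp_smul hφ.contDiff r) hgradc
  rw [← integral_const_mul, ← integral_sub i1 i2, ← sub_nonneg,
    ← integral_sub (by exact i1.sub i2) i3] at hmain
  -- Removing the radial derivative from `|∇φ|²` leaves the squared tangential part, which is `r⁻²`
  -- times the squared spherical gradient. All other terms also scale like `r⁻²`.
  have hpt : ∀ θ : Sph N, (‖gradient φ (r • (θ : RN N))‖ ^ 2 -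
      (‖r • (θ : RN N)‖ ^ 2)⁻¹ * ⟪gradient φ (r • (θ : RN N)), r • (θ : RN N)⟫ ^ 2 -
      (m * ((‖r • (θ : RN N)‖ ^ 2)⁻¹ * φ (r • (θ : RN N)) ^ 2) +
        polePotential h 0 (r • (θ : RN N)) * φ (r • (θ : RN N)) ^ 2)) =
      (r ^ 2)⁻¹ * (‖sphereGrad ψ θ‖ ^ 2 - h θ * ψ θ ^ 2 - m * ψ θ ^ 2) := by
    intro θ
    have hθ : ‖(θ : RN N)‖ = 1 := by simp
    rw [hgrad, polePotential, sub_zero, angular_smul h hr]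
    simp only [norm_smul, hθ, Real.norm_eq_abs, mul_one, sq_abs, mul_pow,
      norm_sub_inner_smul_sq hθ, inner_smul_right, hψ]
    field_simp
    ring
  refine le_of_le_of_eq (mul_nonneg (by positivity : 0 ≤ (r ^ 2)⁻¹) hmain) ?_
  rw [← integral_const_mul]
  exact integral_congr_ae (.of_forall fun θ => (hpt θ).symm)

/-- Hardy's inequality for an anisotropic inverse square potential with pole at the origin. -/
lemma hardy_at_zero {h : Sph N → ℝ} (hh : Continuous h) {φ : RN N → ℝ}
    (hφ : IsTestFunction {0} φ) :
    (sphereFirstEigenvalue h + (((N : ℝ) - 2) / 2) ^ 2) * (∫ x, (‖x‖ ^ 2)⁻¹ * φ x ^ 2) ≤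
      (∫ x, ‖gradient φ x‖ ^ 2) - ∫ x, polePotential h 0 x * φ x ^ 2 := by
  have h1 := hardy_angular hh hφ
  have h2 := hardy_radial hφ
  linarith

/-- Hardy's inequality with a pole at `a`. -/
lemma hardy_at {h : Sph N → ℝ} (hh : Continuous h) (a : RN N) {φ : RN N → ℝ}
    (hφ : IsTestFunction {a} φ) :
    (sphereFirstEigenvalue h + (((N : ℝ) - 2) / 2) ^ 2) * (∫ x, (‖x - a‖ ^ 2)⁻¹ * φ x ^ 2) ≤
      (∫ x, ‖gradient φ x‖ ^ 2) - ∫ x, polePotential h a x * φ x ^ 2 := by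
  have := hardy_at_zero hh hφ.translate
  simp only [gradient_comp_add_right] at this
  rw [← integral_add_right_eq_self (fun x => (‖x - a‖ ^ 2)⁻¹ * φ x ^ 2) a,
    ← integral_add_right_eq_self (fun x => ‖gradient φ x‖ ^ 2) a,
    ← integral_add_right_eq_self (fun x => polePotential h a x * φ x ^ 2) a]
  simpa [polePotential] using this

/-- If `μ₁(h)` is above the Hardy threshold, the potential is a small perturbation of the Dirichlet
form, with room to spare. -/
lemma exists_hardy_gap {h : Sph N → ℝ} (hh : Continuous h)
    (hμ : sphereFirstEigenvalue h > -((((N : ℝ) - 2) / 2) ^ 2)) (a : RN N) :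
    ∃ δ : ℝ, 0 < δ ∧ ∀ φ : RN N → ℝ, IsTestFunction {a} φ →
      (∫ x, polePotential h a x * φ x ^ 2) + δ * (∫ x, (‖x - a‖ ^ 2)⁻¹ * φ x ^ 2) ≤
        (1 - δ) * ∫ x, ‖gradient φ x‖ ^ 2 := by
  obtain ⟨M, hM0, hM⟩ := exists_abs_le_of_continuous hh
  set γ := sphereFirstEigenvalue h + (((N : ℝ) - 2) / 2) ^ 2 with hγ
  have hγ0 : 0 < γ := by rw [hγ]; linarith
  refine ⟨γ / (γ + M + 1), by positivity, fun φ hφ => ?_⟩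
  have hmain := hardy_at hh a hφ
  rw [← hγ] at hmain
  have hH : Integrable (fun x => (‖x - a‖ ^ 2)⁻¹ * φ x ^ 2) :=
    hφ.integrable_mul_sq isClosed_singleton (continuousOn_inv_normSq_sub a)
  have hP : Integrable (fun x => polePotential h a x * φ x ^ 2) :=
    hφ.integrable_mul_sq isClosed_singleton (continuousOn_polePotential hh a)
  have hPH : ∫ x, polePotential h a x * φ x ^ 2 ≤ M * ∫ x, (‖x - a‖ ^ 2)⁻¹ * φ x ^ 2 := by
    rw [← integral_const_mul]
    refine integral_mono hP (hH.const_mul M) fun x => ?_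
    simp only [← mul_assoc]
    exact mul_le_mul_of_nonneg_right
      ((le_abs_self _).trans (abs_polePotential_le hM hM0 a x)) (sq_nonneg _)
  set P := ∫ x, polePotential h a x * φ x ^ 2
  set H := ∫ x, (‖x - a‖ ^ 2)⁻¹ * φ x ^ 2
  set D := ∫ x, ‖gradient φ x‖ ^ 2
  -- Here `γ H ≤ D - P`, and `P ≤ M H` gives `γ D ≤ γ (D - P) + M γ H ≤ (γ + M) (D - P)`. Adding the
  -- two bounds produces the constant `γ + M + 1`.
  have hkey : γ * (H + D) ≤ (γ + M + 1) * (D - P) := by nlinarith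
  have : γ / (γ + M + 1) * (H + D) ≤ D - P := by
    rw [div_mul_eq_mul_div, div_le_iff₀ (by positivity)]
    linarith
  linarith

end Polar

/-! ### Localization of form bounds by cutoffs -/

section Localization

variable {N : ℕ}

/-- Young's inequality on the cross term. The derivative of the cutoff is paid for with a large
constant, so that `∇g` keeps a coefficient close to one. -/
lemma norm_gradient_mul_sq_le {f g : RN N → ℝ} {x : RN N} (hf : DifferentiableAt ℝ f x)
    (hg : DifferentiableAt ℝ g x) {ε : ℝ} (hε : 0 < ε) :
    ‖gradient (fun y => f y * g y) x‖ ^ 2 ≤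
      (1 + ε) * (f x ^ 2 * ‖gradient g x‖ ^ 2) + (1 + ε⁻¹) * (‖gradient f x‖ ^ 2 * g x ^ 2) := by
  rw [gradient_mul hf hg]
  set A := ‖f x • gradient g x‖ with hA
  set B := ‖g x • gradient f x‖ with hB
  have hA2 : A ^ 2 = f x ^ 2 * ‖gradient g x‖ ^ 2 := by
    rw [hA, norm_smul, mul_pow, Real.norm_eq_abs, sq_abs]
  have hB2 : B ^ 2 = ‖gradient f x‖ ^ 2 * g x ^ 2 := by
    rw [hB, norm_smul, mul_pow, Real.norm_eq_abs, sq_abs, mul_comm]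
  rw [← hA2, ← hB2]
  have h1 : ‖f x • gradient g x + g x • gradient f x‖ ^ 2 ≤ (A + B) ^ 2 :=
    pow_le_pow_left₀ (norm_nonneg _) (norm_add_le _ _) 2
  have h2 : 2 * A * B ≤ ε * A ^ 2 + ε⁻¹ * B ^ 2 := by
    have h3 : 0 ≤ ε⁻¹ * (ε * A - B) ^ 2 := by positivity
    have h4 : ε⁻¹ * (ε * A - B) ^ 2 = ε * A ^ 2 - 2 * A * B + ε⁻¹ * B ^ 2 := by
      field_simp
      ring
    linarith
  nlinarith

lemma IsTestFunction.integrable_indicator_mul_sq {s : Set (RN N)} {φ : RN N → ℝ}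
    (hφ : IsTestFunction s φ) {K : Set (RN N)} (hK : MeasurableSet K) (C : ℝ) :
    Integrable (fun x => C * (K.indicator 1 x * φ x ^ 2)) := by
  have h1 : Integrable (fun x => φ x ^ 2) := by
    simpa using (hφ.mono (Set.empty_subset s)).integrable_mul_sq isClosed_empty
      (f := fun _ => 1) continuousOn_const
  refine Integrable.const_mul ?_ C
  refine (h1.indicator hK).congr (.of_forall fun x => ?_)
  by_cases hx : x ∈ K <;> simp [hx]

lemma integral_indicator_mul_sq {φ : RN N → ℝ} {K : Set (RN N)} (hK : MeasurableSet K) :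
    ∫ x, K.indicator 1 x * φ x ^ 2 = ∫ x in K, φ x ^ 2 := by
  rw [← integral_indicator hK]
  refine integral_congr_ae (.of_forall fun x => ?_)
  by_cases hx : x ∈ K <;> simp [hx]

/-- If a potential is dominated, up to a bounded potential supported in `K`, by localized potentials
that are form bounded with constant `1 - δ`, it is itself form bounded up to an `L²(K)` term. -/
lemma form_bound_of_localization {J : Type*} [Fintype J] {s K : Set (RN N)} (hs : IsClosed s)
    (hK : MeasurableSet K) {V : RN N → ℝ} (hV : ContinuousOn V sᶜ) {p : J → RN N}
    {W χ : J → RN N → ℝ} {δ L B : ℝ} (hδ0 : 0 < δ) (hδ1 : δ ≤ 1)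
    (hW : ∀ j, ContinuousOn (W j) {p j}ᶜ) (hχ : ∀ j, ContDiff ℝ ∞ (χ j))
    (hsum : ∀ x, ∑ j, χ j x ^ 2 ≤ 1)
    (hgrad : ∀ j x, ‖gradient (χ j) x‖ ^ 2 ≤ L * K.indicator 1 x)
    (hsupp : ∀ j φ, IsTestFunction s φ → IsTestFunction {p j} (fun x => χ j x * φ x))
    (hpt : ∀ x ∉ s, V x ≤ ∑ j, W j x * χ j x ^ 2 + B * K.indicator 1 x)
    (hHardy : ∀ j φ, IsTestFunction {p j} φ →
      ∫ x, W j x * φ x ^ 2 ≤ (1 - δ) * ∫ x, ‖gradient φ x‖ ^ 2) :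
    ∃ C : ℝ, ∀ φ, IsTestFunction s φ →
      ∫ x, V x * φ x ^ 2 ≤ (1 - δ / 2) * (∫ x, ‖gradient φ x‖ ^ 2) + C * ∫ x in K, φ x ^ 2 := by
  -- This choice gives `(1 - δ) (1 + ε) ≤ 1 - δ / 2`.
  set ε := δ / 2 with hε
  have hε0 : 0 < ε := by positivity
  set C' := (1 + ε⁻¹) * (Fintype.card J * L) with hC'
  refine ⟨(1 - δ) * C' + B, fun φ hφ => ?_⟩
  have hdiff : Differentiable ℝ φ := hφ.contDiff.differentiable (by simp)
  have hVi : Integrable fun x => V x * φ x ^ 2 := hφ.integrable_mul_sq hs hV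
  have hWi : ∀ j, Integrable fun x => W j x * (χ j x * φ x) ^ 2 := fun j =>
    (hsupp j φ hφ).integrable_mul_sq isClosed_singleton (hW j)
  have hWs : Integrable fun x => ∑ j, W j x * (χ j x * φ x) ^ 2 :=
    integrable_finsetSum _ fun j _ => hWi j
  have hDi := integrable_normSq_gradient (hφ.contDiff.of_le (by simp)) hφ.hasCompactSupport
  have hDji : ∀ j, Integrable fun x => ‖gradient (fun y => χ j y * φ y) x‖ ^ 2 := fun j =>
    integrable_normSq_gradient ((hsupp j φ hφ).contDiff.of_le (by simp))
      (hsupp j φ hφ).hasCompactSupport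
  have hDs : Integrable fun x => ∑ j, ‖gradient (fun y => χ j y * φ y) x‖ ^ 2 :=
    integrable_finsetSum _ fun j _ => hDji j
  have step1 : ∫ x, V x * φ x ^ 2 ≤
      (∑ j, ∫ x, W j x * (χ j x * φ x) ^ 2) + B * ∫ x in K, φ x ^ 2 := by
    rw [← integral_finsetSum _ fun j _ => hWi j, ← integral_indicator_mul_sq hK,
      ← integral_const_mul, ← integral_add hWs (hφ.integrable_indicator_mul_sq hK B)]
    refine integral_mono hVi (hWs.add (hφ.integrable_indicator_mul_sq hK B)) fun x => ?_
    by_cases hx : x ∈ s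
    · have h0 : φ x = 0 := by
        by_contra h
        exact Set.disjoint_left.1 hφ.disjoint (subset_tsupport _ h) hx
      simp [h0]
    · have := mul_le_mul_of_nonneg_right (hpt x hx) (sq_nonneg (φ x))
      refine this.trans_eq ?_
      rw [add_mul, Finset.sum_mul]
      congr 1
      · exact Finset.sum_congr rfl fun j _ => by ring
      · ring
  have step2 : ∑ j, ∫ x, ‖gradient (fun y => χ j y * φ y) x‖ ^ 2 ≤
      (1 + ε) * (∫ x, ‖gradient φ x‖ ^ 2) + C' * ∫ x in K, φ x ^ 2 := by
    rw [← integral_finsetSum _ fun j _ => hDji j, ← integral_indicator_mul_sq hK,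
      ← integral_const_mul, ← integral_const_mul,
      ← integral_add (hDi.const_mul _) (hφ.integrable_indicator_mul_sq hK C')]
    refine integral_mono hDs ((hDi.const_mul _).add (hφ.integrable_indicator_mul_sq hK C'))
      fun x => ?_
    have h1 : ∀ j, ‖gradient (fun y => χ j y * φ y) x‖ ^ 2 ≤
        (1 + ε) * (χ j x ^ 2 * ‖gradient φ x‖ ^ 2) +
          (1 + ε⁻¹) * (L * K.indicator 1 x * φ x ^ 2) := fun j => by
      refine (norm_gradient_mul_sq_le ((hχ j).differentiable (by simp) x) (hdiff x) hε0).trans ?_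
      gcongr
      exact hgrad j x
    refine (Finset.sum_le_sum fun j _ => h1 j).trans ?_
    rw [Finset.sum_add_distrib, ← Finset.mul_sum, ← Finset.sum_mul, Finset.sum_const,
      Finset.card_univ, nsmul_eq_mul]
    have h2 : (∑ j, χ j x ^ 2) * ‖gradient φ x‖ ^ 2 ≤ 1 * ‖gradient φ x‖ ^ 2 :=
      mul_le_mul_of_nonneg_right (hsum x) (sq_nonneg _)
    have h3 := mul_le_mul_of_nonneg_left h2 (by positivity : 0 ≤ 1 + ε)
    rw [hC']
    linarith
  have step3 : ∑ j, ∫ x, W j x * (χ j x * φ x) ^ 2 ≤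
      (1 - δ) * ∑ j, ∫ x, ‖gradient (fun y => χ j y * φ y) x‖ ^ 2 := by
    rw [Finset.mul_sum]
    exact Finset.sum_le_sum fun j _ => hHardy j _ (hsupp j φ hφ)
  have hD0 : 0 ≤ ∫ x, ‖gradient φ x‖ ^ 2 := integral_nonneg fun x => sq_nonneg _
  have step4 := mul_le_mul_of_nonneg_left step2 (by linarith : 0 ≤ 1 - δ)
  have step5 : (1 - δ) * ((1 + ε) * ∫ x, ‖gradient φ x‖ ^ 2) ≤
      (1 - δ / 2) * ∫ x, ‖gradient φ x‖ ^ 2 := by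
    rw [← mul_assoc]
    refine mul_le_mul_of_nonneg_right ?_ hD0
    nlinarith
  rw [← hε] at step5
  linarith

end Localization

/-! ### The potential at infinity -/

section Asymptotics

variable {N : ℕ}

lemma angular_smul_right (h : Sph N → ℝ) {t : ℝ} (ht : 0 < t) (y : RN N) :
    angular h (t • y) = angular h y := by
  by_cases hy : y = 0
  · simp [hy]
  · have hty : t • y ≠ 0 := smul_ne_zero ht.ne' hy
    rw [angular_of_ne_zero h hty, angular_of_ne_zero h hy]
    congr 1
    ext1
    simp only [norm_smul, Real.norm_eq_abs, abs_of_pos ht, mul_inv, smul_smul]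
    congr 1
    field_simp

lemma polePotential_zero_smul (h : Sph N → ℝ) {t : ℝ} (ht : 0 < t) (y : RN N) :
    polePotential h 0 (t • y) = (t ^ 2)⁻¹ * polePotential h 0 y := by
  simp only [polePotential, sub_zero, angular_smul_right h ht, norm_smul, Real.norm_eq_abs,
    abs_of_pos ht, mul_pow]
  field_simp

lemma polePotential_eq (h : Sph N → ℝ) (a x : RN N) :
    polePotential h a x = polePotential h 0 (x - a) := by
  simp [polePotential]

lemma polePotential_sum {k : ℕ} (h : Fin k → Sph N → ℝ) (a x : RN N) :
    polePotential (fun θ => ∑ i, h i θ) a x = ∑ i, polePotential (h i) a x := by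
  simp only [polePotential, ← Finset.sum_div]
  congr 1
  by_cases hx : x - a = 0
  · simp [angular, hx]
  · simp [angular_of_ne_zero _ hx]

/-- At infinity the position of the pole is irrelevant to leading order. -/
lemma eventually_abs_polePotential_sub_le {h : Sph N → ℝ} (hh : Continuous h) (a : RN N)
    {ε : ℝ} (hε : 0 < ε) :
    ∀ᶠ x in Bornology.cobounded (RN N),
      |polePotential h a x - polePotential h 0 x| ≤ ε * (‖x‖ ^ 2)⁻¹ := by
  -- By homogeneity of degree `-2` the claim can be rescaled by `|x|`. The points `x / |x|` and `(x
  -- - a) / |x|` lie in this compact annulus at distance `|a| / |x|`, where the potential is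
  -- uniformly continuous.
  set K : Set (RN N) := closedBall 0 2 \ ball 0 (1 / 2) with hKdef
  have hK : IsCompact K := (isCompact_closedBall 0 2).diff isOpen_ball
  have hcont : ContinuousOn (polePotential h 0) K :=
    (continuousOn_polePotential hh 0).mono fun y hy => by
      rintro rfl
      exact hy.2 (by simp)
  obtain ⟨d, hd0, hd⟩ := Metric.uniformContinuousOn_iff.1
    (hK.uniformContinuousOn_of_continuous hcont) ε hε
  have hlarge : ∀ᶠ x in Bornology.cobounded (RN N), max 1 (max (2 * ‖a‖) ((‖a‖ + 1) / d)) ≤ ‖x‖ :=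
    tendsto_norm_cobounded_atTop.eventually_ge_atTop _
  filter_upwards [hlarge] with x hx
  obtain ⟨hx1, hx2, hx3⟩ : 1 ≤ ‖x‖ ∧ 2 * ‖a‖ ≤ ‖x‖ ∧ (‖a‖ + 1) / d ≤ ‖x‖ :=
    ⟨(le_max_left _ _).trans hx, ((le_max_left _ _).trans (le_max_right _ _)).trans hx,
      ((le_max_right _ _).trans (le_max_right _ _)).trans hx⟩
  have hx0 : 0 < ‖x‖ := by linarith
  set y := ‖x‖⁻¹ • x with hy
  set z := ‖x‖⁻¹ • (x - a) with hz
  have hny : ‖y‖ = 1 := by rw [hy, norm_smul, norm_inv, norm_norm, inv_mul_cancel₀ hx0.ne']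
  have hxy : x = ‖x‖ • y := by rw [hy, smul_smul, mul_inv_cancel₀ hx0.ne', one_smul]
  have hxz : x - a = ‖x‖ • z := by rw [hz, smul_smul, mul_inv_cancel₀ hx0.ne', one_smul]
  have hdist : dist z y = ‖x‖⁻¹ * ‖a‖ := by
    rw [dist_eq_norm, hz, hy, ← smul_sub, norm_smul, norm_inv, norm_norm]
    simp
  have hd1 : dist z y ≤ 1 / 2 := by
    rw [hdist, inv_mul_le_iff₀ hx0]
    linarith
  have hd2 : dist z y < d := by
    rw [div_le_iff₀ hd0] at hx3
    rw [hdist, inv_mul_lt_iff₀ hx0]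
    linarith
  have hyK : y ∈ K := by
    simp only [hKdef, Set.mem_sdiff, mem_closedBall, mem_ball, dist_zero_right, hny]
    norm_num
  have hzK : z ∈ K := by
    have h1 : ‖z‖ ≤ dist z y + ‖y‖ := by
      rw [dist_eq_norm]
      simpa using norm_add_le (z - y) y
    have h2 : ‖y‖ ≤ dist z y + ‖z‖ := by
      rw [dist_comm, dist_eq_norm]
      simpa using norm_add_le (y - z) z
    simp only [hKdef, Set.mem_sdiff, mem_closedBall, mem_ball, dist_zero_right, not_lt]
    constructor <;> linarith
  have hfin := hd z hzK y hyK hd2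
  rw [Real.dist_eq] at hfin
  have e1 : polePotential h a x = (‖x‖ ^ 2)⁻¹ * polePotential h 0 z := by
    rw [polePotential_eq, hxz, polePotential_zero_smul h hx0]
  have e2 : polePotential h 0 x = (‖x‖ ^ 2)⁻¹ * polePotential h 0 y := by
    conv_lhs => rw [hxy]
    rw [polePotential_zero_smul h hx0]
  rw [e1, e2, ← mul_sub, abs_mul, abs_of_nonneg (by positivity), mul_comm]
  gcongr

lemma exists_radius_abs_sum_polePotential_sub_le {k : ℕ} {h : Fin k → Sph N → ℝ}
    (hh : ∀ i, Continuous (h i)) (a : Fin k → RN N) {ε : ℝ} (hε : 0 < ε) :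
    ∃ R : ℝ, ∀ x, R ≤ ‖x‖ → |∑ i, polePotential (h i) (a i) x -
      polePotential (fun θ => ∑ i, h i θ) 0 x| ≤ ε * (‖x‖ ^ 2)⁻¹ := by
  have hev : ∀ᶠ x in Bornology.cobounded (RN N), |∑ i, polePotential (h i) (a i) x -
      polePotential (fun θ => ∑ i, h i θ) 0 x| ≤ ε * (‖x‖ ^ 2)⁻¹ := by
    -- Dividing by `k + 1` rather than `k` also covers the case without poles.
    have hk : 0 < (k : ℝ) + 1 := by positivity
    have := eventually_all.2 fun i =>
      eventually_abs_polePotential_sub_le (hh i) (a i) (div_pos hε hk)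
    filter_upwards [this] with x hx
    rw [polePotential_sum, ← Finset.sum_sub_distrib]
    refine (Finset.abs_sum_le_sum_abs _ _).trans ((Finset.sum_le_sum fun i _ => hx i).trans ?_)
    rw [Finset.sum_const, Finset.card_univ, Fintype.card_fin, nsmul_eq_mul, ← mul_assoc]
    refine mul_le_mul_of_nonneg_right ?_ (by positivity)
    rw [mul_div_assoc', div_le_iff₀ hk]
    nlinarith
  obtain ⟨R, -, hR⟩ := (hasBasis_cobounded_norm.eventually_iff).1 hev
  exact ⟨R, fun x hx => hR hx⟩

end Asymptotics

/-! ### Form bound for the multipolar potential -/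

section MultiPole

variable {N : ℕ}

lemma exists_gradient_sq_bound {f : RN N → ℝ} (hf : ContDiff ℝ 1 f) {K : Set (RN N)}
    (hK : IsCompact K) (h0 : ∀ x ∉ K, gradient f x = 0) :
    ∃ L : ℝ, 0 ≤ L ∧ ∀ x, ‖gradient f x‖ ^ 2 ≤ L * K.indicator 1 x := by
  obtain ⟨M, hM⟩ := hK.exists_bound_of_continuousOn (continuous_gradient hf).continuousOn
  refine ⟨M ^ 2, sq_nonneg _, fun x => ?_⟩
  by_cases hx : x ∈ K
  · simpa [hx] using pow_le_pow_left₀ (norm_nonneg _) (hM x hx) 2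
  · simp [hx, h0 x hx]

lemma IsTestFunction.mul_left {s : Set (RN N)} {χ φ : RN N → ℝ} (hφ : IsTestFunction s φ)
    (hχ : ContDiff ℝ ∞ χ) : IsTestFunction s (fun x => χ x * φ x) :=
  ⟨hχ.mul hφ.contDiff, hφ.hasCompactSupport.mul_left,
    hφ.disjoint.mono_left (tsupport_mul_subset_right)⟩

lemma exists_separation {k : ℕ} {a : Fin k → RN N} (ha : Function.Injective a) :
    ∃ r : ℝ, 0 < r ∧ ∀ i j, i ≠ j → 2 * r ≤ dist (a i) (a j) := by
  have h1 : ∀ᶠ r in 𝓝[>] (0 : ℝ), ∀ i j, i ≠ j → 2 * r ≤ dist (a i) (a j) := by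
    refine eventually_all.2 fun i => eventually_all.2 fun j => ?_
    by_cases hij : i = j
    · exact .of_forall fun _ h => absurd hij h
    · have hd : 0 < dist (a i) (a j) := dist_pos.2 (ha.ne hij)
      filter_upwards [Ioo_mem_nhdsGT (half_pos hd)] with r hr _
      linarith [hr.2]
  obtain ⟨r, hr, hr0⟩ := (h1.and self_mem_nhdsWithin).exists
  exact ⟨r, hr0, hr⟩

variable [Fact (3 ≤ N)]

/-- The multipolar potential is form bounded with a constant less than one, up to an `L²` term on a
ball. -/
lemma exists_localized_form_bound {k : ℕ} {h : Fin k → Sph N → ℝ} (hh : ∀ i, Continuous (h i))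
    {a : Fin k → RN N} (ha : Function.Injective a)
    (hμ : ∀ i, sphereFirstEigenvalue (h i) > -((((N : ℝ) - 2) / 2) ^ 2))
    (hμsum : sphereFirstEigenvalue (fun θ => ∑ i, h i θ) > -((((N : ℝ) - 2) / 2) ^ 2)) :
    ∃ δ C R : ℝ, 0 < δ ∧ ∀ φ, IsTestFunction (Set.range a) φ →
      ∫ x, (∑ i, polePotential (h i) (a i) x) * φ x ^ 2 ≤
        (1 - δ) * (∫ x, ‖gradient φ x‖ ^ 2) + C * ∫ x in closedBall 0 R, φ x ^ 2 := by
  have hsumc : Continuous fun θ => ∑ i, h i θ := continuous_finsetSum _ fun i _ => hh i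
  -- poles and profiles, `none` standing for infinity
  let p : Option (Fin k) → RN N := fun j => j.elim 0 a
  let H : Option (Fin k) → Sph N → ℝ := fun j => j.elim (fun θ => ∑ i, h i θ) h
  have hH : ∀ j, Continuous (H j) := by
    rintro (_ | i)
    exacts [hsumc, hh i]
  have hgap : ∀ j, ∃ δ : ℝ, 0 < δ ∧ ∀ φ : RN N → ℝ, IsTestFunction {p j} φ →
      (∫ x, polePotential (H j) (p j) x * φ x ^ 2) +
        δ * (∫ x, (‖x - p j‖ ^ 2)⁻¹ * φ x ^ 2) ≤ (1 - δ) * ∫ x, ‖gradient φ x‖ ^ 2 := by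
    rintro (_ | i)
    exacts [exists_hardy_gap hsumc hμsum 0, exists_hardy_gap (hh i) (hμ i) (a i)]
  choose d hd0 hd using hgap
  obtain ⟨δ, ⟨hδd, hδ1⟩, hδ0⟩ : ∃ δ : ℝ, ((∀ j, δ ≤ d j) ∧ δ ≤ 1) ∧ 0 < δ := by
    have h1 : ∀ᶠ δ in 𝓝[>] (0 : ℝ), (∀ j, δ ≤ d j) ∧ δ ≤ 1 := by
      refine (eventually_all.2 fun j => ?_).and ?_
      · filter_upwards [Ioo_mem_nhdsGT (hd0 j)] with t ht using ht.2.le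
      · filter_upwards [Ioo_mem_nhdsGT one_pos] with t ht using ht.2.le
    exact (h1.and self_mem_nhdsWithin).exists
  obtain ⟨r, hr0, hsep⟩ := exists_separation ha
  obtain ⟨R₀, hR₀⟩ := exists_radius_abs_sum_polePotential_sub_le hh a hδ0
  -- Beyond `R` the total potential differs from the single pole at the origin by at most `δ /
  -- |x|²`, and the ball of radius `R` contains all the `r`-balls around the poles.
  obtain ⟨R, hRR₀, hR1, hRa⟩ : ∃ R : ℝ, R₀ ≤ R ∧ 1 ≤ R ∧ ∀ i, ‖a i‖ + r ≤ R := by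
    have h1 : ∀ᶠ R in atTop, R₀ ≤ R ∧ (1 : ℝ) ≤ R ∧ ∀ i, ‖a i‖ + r ≤ R :=
      (eventually_ge_atTop _).and ((eventually_ge_atTop _).and
        (eventually_all.2 fun i => eventually_ge_atTop _))
    exact h1.exists
  choose M hM0 hM using fun i => exists_abs_le_of_continuous (hh i)
  -- cutoff functions
  let b : ∀ i, ContDiffBump (a i) := fun i => ⟨r / 2, r, half_pos hr0, half_lt_self hr0⟩
  let b₀ : ContDiffBump (0 : RN N) := ⟨R, 2 * R, by linarith, by linarith⟩
  let χ : Option (Fin k) → RN N → ℝ := fun j => j.elim (fun x => 1 - b₀ x) (fun i => b i)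
  set K : Set (RN N) := closedBall 0 (2 * R) with hKdef
  have hKc : IsCompact K := isCompact_closedBall _ _
  have hχ : ∀ j, ContDiff ℝ ∞ (χ j) := by
    rintro (_ | i)
    exacts [contDiff_const.sub b₀.contDiff, (b i).contDiff]
  have hgrad0 : ∀ j, ∀ x ∉ K, gradient (χ j) x = 0 := by
    rintro (_ | i) x hx
    · have h1 : x ∉ tsupport b₀ := by rwa [b₀.tsupport_eq]
      have h2 : χ none =ᶠ[𝓝 x] fun _ => 1 := by
        filter_upwards [notMem_tsupport_iff_eventuallyEq.1 h1] with y hy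
        simp [χ, hy]
      rw [h2.gradient_eq, gradient_fun_const]
    · have h1 : x ∉ tsupport (b i) := by
        rw [(b i).tsupport_eq]
        intro hx'
        refine hx ?_
        rw [mem_closedBall, dist_zero_right]
        have h3 : ‖x‖ ≤ ‖x - a i‖ + ‖a i‖ := by simpa using norm_add_le (x - a i) (a i)
        have h4 : ‖x - a i‖ ≤ r := by simpa [dist_eq_norm] using hx'
        linarith [hRa i]
      by_contra h5
      exact h1 (tsupport_gradient_subset _ (subset_tsupport _ h5))
  choose L hL0 hL using fun j => exists_gradient_sq_bound ((hχ j).of_le (by simp)) hKc (hgrad0 j)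
  -- `χ none` vanishes on the balls around the poles, and these are disjoint
  have hχnone : ∀ x, ‖x‖ ≤ R → χ none x = 0 := by
    intro x hx
    have : b₀ x = 1 := b₀.one_of_mem_closedBall (by simpa [b₀] using hx)
    simp [χ, this]
  have hnear : ∀ x i, dist x (a i) < r → ‖x‖ ≤ R ∧ ∀ l, l ≠ i → r ≤ dist x (a l) := by
    intro x i hx
    constructor
    · have h3 : ‖x‖ ≤ ‖x - a i‖ + ‖a i‖ := by simpa using norm_add_le (x - a i) (a i)
      rw [dist_eq_norm] at hx
      linarith [hRa i]
    · intro l hl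
      have h1 := hsep l i hl
      have h2 := dist_triangle (a l) x (a i)
      rw [dist_comm (a l) x] at h2
      linarith
  have hbzero : ∀ x i, r ≤ dist x (a i) → b i x = 0 := fun x i hx =>
    (b i).zero_of_le_dist hx
  have hsumχ : ∀ f : Option (Fin k) → ℝ, ∀ x i, dist x (a i) < r →
      ∑ j, f j * χ j x ^ 2 = f (some i) * b i x ^ 2 := by
    intro f x i hx
    rw [Fintype.sum_option, hχnone x (hnear x i hx).1, Finset.sum_eq_single i]
    · simp [χ]
    · intro l _ hl
      simp [χ, hbzero x l ((hnear x i hx).2 l hl)]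
    · simp
  have hsumχ' : ∀ f : Option (Fin k) → ℝ, ∀ x, (∀ i, r ≤ dist x (a i)) →
      ∑ j, f j * χ j x ^ 2 = f none * χ none x ^ 2 := by
    intro f x hx
    rw [Fintype.sum_option, Finset.sum_eq_zero, add_zero]
    intro i _
    simp [χ, hbzero x i (hx i)]
  have hχnone01 : ∀ x, 0 ≤ χ none x ∧ χ none x ≤ 1 := fun x =>
    ⟨sub_nonneg.2 b₀.le_one, sub_le_self _ b₀.nonneg⟩
  -- The extra `δ / |x - p|²` is the room left by Hardy's inequality. At infinity it pays for moving
  -- all the poles to the origin.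
  let W : Option (Fin k) → RN N → ℝ := fun j x =>
    polePotential (H j) (p j) x + δ * (‖x - p j‖ ^ 2)⁻¹
  -- A bound for the sum of those potentials whose own pole is at distance at least `r / 2`.
  set B : ℝ := ∑ i, M i * ((r / 2) ^ 2)⁻¹ with hB
  have hB0 : 0 ≤ B := Finset.sum_nonneg fun i _ => mul_nonneg (hM0 i) (by positivity)
  have hVi : ∀ x i, r / 2 ≤ dist x (a i) →
      |polePotential (h i) (a i) x| ≤ M i * ((r / 2) ^ 2)⁻¹ := by
    intro x i hx
    refine (abs_polePotential_le (hM i) (hM0 i) (a i) x).trans ?_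
    rw [dist_eq_norm] at hx
    have := hM0 i
    gcongr
  have hsq1 : ∀ t : ℝ, 0 ≤ t → t ≤ 1 → t ^ 2 ≤ 1 := fun t h0 h1 => pow_le_one₀ h0 h1
  obtain ⟨C, hC⟩ := form_bound_of_localization (J := Option (Fin k)) (s := Set.range a) (K := K)
    (V := fun x => ∑ i, polePotential (h i) (a i) x) (p := p) (W := W) (χ := χ) (δ := δ)
    (L := ∑ j, L j) (B := B) (Set.finite_range a).isClosed measurableSet_closedBall
    (continuousOn_finsetSum _ fun i _ => (continuousOn_polePotential (hh i) (a i)).mono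
      (Set.compl_subset_compl.2 (by simp))) hδ0 hδ1
    (fun j => (continuousOn_polePotential (hH j) (p j)).add
      (continuousOn_const.mul (continuousOn_inv_normSq_sub (p j)))) hχ
    (by
      intro x
      by_cases hx : ∃ i, dist x (a i) < r
      · obtain ⟨i, hi⟩ := hx
        have := hsumχ (fun _ => 1) x i hi
        simp only [one_mul] at this
        rw [this]
        exact hsq1 _ (b i).nonneg (b i).le_one
      · push Not at hx
        have := hsumχ' (fun _ => 1) x hx
        simp only [one_mul] at this
        rw [this]
        exact hsq1 _ (hχnone01 x).1 (hχnone01 x).2)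
    (by
      intro j x
      refine (hL j x).trans (mul_le_mul_of_nonneg_right ?_ ?_)
      · exact Finset.single_le_sum (fun j _ => hL0 j) (Finset.mem_univ j)
      · exact Set.indicator_nonneg (fun _ _ => zero_le_one) x)
    (by
      rintro (_ | i) φ hφ
      · refine ⟨(hφ.mul_left (hχ none)).contDiff, (hφ.mul_left (hχ none)).hasCompactSupport, ?_⟩
        rw [Set.disjoint_singleton_right]
        intro h0
        have h1 := tsupport_mul_subset_left (f := χ none) (g := φ) h0
        rw [← not_not (a := p none ∈ tsupport (χ none)), notMem_tsupport_iff_eventuallyEq] at h1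
        refine h1 ?_
        filter_upwards [ball_mem_nhds (0 : RN N) (by linarith : 0 < R)] with y hy
        exact hχnone y (by simpa using (mem_ball.1 hy).le)
      · exact (hφ.mul_left (hχ (some i))).mono (by simp [p]))
    (by
      intro x hx
      by_cases hx' : ∃ i, dist x (a i) < r
      · obtain ⟨i, hi⟩ := hx'
        have hxK : x ∈ K := by
          rw [hKdef, mem_closedBall, dist_zero_right]
          linarith [(hnear x i hi).1]
        rw [hsumχ (fun j => W j x) x i hi, Set.indicator_of_mem hxK, Pi.one_apply, mul_one,
          ← Finset.add_sum_erase _ _ (Finset.mem_univ i), hB,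
          ← Finset.add_sum_erase _ (fun i => M i * ((r / 2) ^ 2)⁻¹) (Finset.mem_univ i)]
        have h1 : ∑ l ∈ Finset.univ.erase i, polePotential (h l) (a l) x ≤
            ∑ l ∈ Finset.univ.erase i, M l * ((r / 2) ^ 2)⁻¹ := by
          refine Finset.sum_le_sum fun l hl => (le_abs_self _).trans (hVi x l ?_)
          linarith [(hnear x i hi).2 l (Finset.ne_of_mem_erase hl)]
        have h2 : polePotential (h i) (a i) x * b i x ^ 2 ≤ W (some i) x * b i x ^ 2 := by
          refine mul_le_mul_of_nonneg_right (le_add_of_nonneg_right ?_) (sq_nonneg _)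
          positivity
        -- The bump equals one within `r / 2` of the pole, so the part it leaves over lives where
        -- the potential is bounded.
        have h3 : polePotential (h i) (a i) x * (1 - b i x ^ 2) ≤ M i * ((r / 2) ^ 2)⁻¹ := by
          have hm : 0 ≤ M i * ((r / 2) ^ 2)⁻¹ := mul_nonneg (hM0 i) (by positivity)
          by_cases hxr : dist x (a i) ≤ r / 2
          · have : b i x = 1 := (b i).one_of_mem_closedBall hxr
            simpa [this] using hm
          · push Not at hxr
            have h4 : (1 - b i x ^ 2) ≤ 1 := sub_le_self _ (sq_nonneg _)
            have h5 : 0 ≤ 1 - b i x ^ 2 := sub_nonneg.2 (hsq1 _ (b i).nonneg (b i).le_one)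
            have h6 := (le_abs_self _).trans (hVi x i hxr.le)
            nlinarith
        linarith
      · push Not at hx'
        rw [hsumχ' (fun j => W j x) x hx']
        have hVB : ∑ i, polePotential (h i) (a i) x ≤ B :=
          Finset.sum_le_sum fun i _ => (le_abs_self _).trans (hVi x i (by linarith [hx' i]))
        by_cases hxR : ‖x‖ < R
        · have hxK : x ∈ K := by
            rw [hKdef, mem_closedBall, dist_zero_right]
            linarith
          rw [hχnone x hxR.le, Set.indicator_of_mem hxK]
          simpa using hVB
        · push Not at hxR
          have h1 : ∑ i, polePotential (h i) (a i) x ≤ W none x := by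
            have := (abs_le.1 (hR₀ x (hRR₀.trans hxR))).2
            simp only [W, H, p, Option.elim, sub_zero]
            linarith
          -- In the transition shell both `V ≤ W` and `V ≤ B` hold, and their combination with
          -- weights `χ²` and `1 - χ²` gives the bound. Outside `K` the cutoff is one and no bounded
          -- term is needed.
          by_cases hxK : x ∈ K
          · rw [Set.indicator_of_mem hxK, Pi.one_apply, mul_one]
            have h2 : 0 ≤ χ none x ^ 2 := sq_nonneg _
            have h3 : χ none x ^ 2 ≤ 1 := hsq1 _ (hχnone01 x).1 (hχnone01 x).2
            nlinarith
          · have h2 : χ none x = 1 := by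
              have : b₀ x = 0 := b₀.zero_of_le_dist (by
                rw [hKdef, mem_closedBall] at hxK
                exact (not_le.1 hxK).le)
              simp [χ, this]
            rw [h2, Set.indicator_of_notMem hxK]
            simpa using h1)
    (by
      intro j φ hφ
      have hi1 : Integrable fun x => polePotential (H j) (p j) x * φ x ^ 2 :=
        hφ.integrable_mul_sq isClosed_singleton (continuousOn_polePotential (hH j) (p j))
      have hi2 : Integrable fun x => (‖x - p j‖ ^ 2)⁻¹ * φ x ^ 2 :=
        hφ.integrable_mul_sq isClosed_singleton (continuousOn_inv_normSq_sub (p j))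
      have h1 : ∫ x, W j x * φ x ^ 2 = (∫ x, polePotential (H j) (p j) x * φ x ^ 2) +
          δ * ∫ x, (‖x - p j‖ ^ 2)⁻¹ * φ x ^ 2 := by
        rw [← integral_const_mul, ← integral_add hi1 (hi2.const_mul δ)]
        refine integral_congr_ae (.of_forall fun x => ?_)
        simp only [W]
        ring
      have h2 : 0 ≤ ∫ x, (‖x - p j‖ ^ 2)⁻¹ * φ x ^ 2 :=
        integral_nonneg fun x => by positivity
      have h3 : 0 ≤ ∫ x, ‖gradient φ x‖ ^ 2 := integral_nonneg fun x => by positivity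
      rw [h1]
      nlinarith [hd j φ hφ, mul_le_mul_of_nonneg_right (hδd j) h2,
        mul_le_mul_of_nonneg_right (hδd j) h3])
  exact ⟨δ / 2, C, 2 * R, by positivity, hC⟩

end MultiPole

/-! ### A globally smooth substitute for `1 / (t + ε)` -/

section Regularization

/-- A smooth bounded function with bounded derivative that agrees with `t ↦ 1 / (t + ε)` for
positive `t`. -/
lemma exists_smooth_inv_add {ε : ℝ} (hε : 0 < ε) :
    ∃ (q : ℝ → ℝ) (C : ℝ), ContDiff ℝ ∞ q ∧ (∀ t, |q t| ≤ C) ∧ (∀ t, |deriv q t| ≤ C) ∧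
      ∀ t, 0 < t → q t = (t + ε)⁻¹ ∧ deriv q t = -((t + ε) ^ 2)⁻¹ := by
  -- Equal to `t + ε` for `t ≥ 0` and to `ε` for `t ≤ -ε / 2`, and at least `ε / 2` everywhere. Its
  -- reciprocal can therefore be composed with approximants of `v` that change sign.
  let F : ℝ → ℝ := fun t => ε + t * Real.smoothTransition (1 + 2 * t / ε)
  have hF : ContDiff ℝ ∞ F := by
    refine contDiff_const.add (contDiff_id.mul (Real.smoothTransition.contDiff.comp ?_))
    exact contDiff_const.add ((contDiff_const.mul contDiff_id).div_const ε)
  have hFpos : ∀ t, 0 ≤ t → F t = t + ε := by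
    intro t ht
    have : Real.smoothTransition (1 + 2 * t / ε) = 1 :=
      Real.smoothTransition.one_of_one_le (by have : 0 ≤ 2 * t / ε := by positivity
                                              linarith)
    simp only [F, this]
    ring
  have hFneg : ∀ t, t ≤ -(ε / 2) → F t = ε := by
    intro t ht
    have : Real.smoothTransition (1 + 2 * t / ε) = 0 := by
      refine Real.smoothTransition.zero_of_nonpos ?_
      have : 2 * t / ε ≤ -1 := by
        rw [div_le_iff₀ hε]
        linarith
      linarith
    simp [F, this]
  have hFlow : ∀ t, ε / 2 ≤ F t := by
    intro t
    rcases le_total t (-(ε / 2)) with h1 | h1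
    · rw [hFneg t h1]
      linarith
    · rcases le_total 0 t with h2 | h2
      · rw [hFpos t h2]
        linarith
      · have h3 := Real.smoothTransition.nonneg (1 + 2 * t / ε)
        have h4 := Real.smoothTransition.le_one (1 + 2 * t / ε)
        simp only [F]
        nlinarith
  have hFne : ∀ t, F t ≠ 0 := fun t => by linarith [hFlow t]
  let q : ℝ → ℝ := fun t => (F t)⁻¹
  have hq : ContDiff ℝ ∞ q := hF.inv hFne
  have hqb : ∀ t, |q t| ≤ 2 / ε := by
    intro t
    have h1 := hFlow t
    rw [abs_of_nonneg (inv_nonneg.2 (by linarith)), ← inv_div]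
    exact inv_anti₀ (by positivity) h1
  have hqd : ∀ t, 0 < t → deriv q t = -((t + ε) ^ 2)⁻¹ := by
    intro t ht
    have h1 : q =ᶠ[𝓝 t] fun s => (s + ε)⁻¹ := by
      filter_upwards [Ioi_mem_nhds ht] with s hs
      simp only [q, hFpos s (le_of_lt hs)]
    rw [h1.deriv_eq]
    have h2 : HasDerivAt (fun s : ℝ => (s + ε)⁻¹) (-1 / (t + ε) ^ 2) t :=
      ((hasDerivAt_id t).add_const ε).inv (by simp; linarith)
    rw [h2.deriv]
    ring
  have hqd' : ∀ t, t < -(ε / 2) → deriv q t = 0 := by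
    intro t ht
    have h1 : q =ᶠ[𝓝 t] fun _ => ε⁻¹ := by
      filter_upwards [Iio_mem_nhds ht] with s hs
      simp only [q, hFneg s (le_of_lt hs)]
    rw [h1.deriv_eq, deriv_const]
  obtain ⟨M, hM⟩ := (isCompact_Icc (a := -(ε / 2)) (b := 0)).exists_bound_of_continuousOn
    (hq.continuous_deriv (by simp)).continuousOn
  refine ⟨q, max (2 / ε) (max M (ε ^ 2)⁻¹), hq, fun t => (hqb t).trans (le_max_left _ _), ?_,
    fun t ht => ⟨by simp only [q, hFpos t ht.le], hqd t ht⟩⟩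
  intro t
  rcases lt_or_ge t (-(ε / 2)) with h1 | h1
  · rw [hqd' t h1, abs_zero]
    exact (by positivity : 0 ≤ 2 / ε).trans (le_max_left _ _)
  · rcases lt_or_ge 0 t with h2 | h2
    · rw [hqd t h2, abs_neg, abs_of_nonneg (by positivity)]
      refine le_trans ?_ ((le_max_right _ _).trans (le_max_right _ _))
      gcongr
      linarith
    · exact (hM t ⟨h1, h2⟩).trans ((le_max_left _ _).trans (le_max_right _ _))

end Regularization

/-! ### Testing the equation: Picone's inequality -/

section Solution

variable {N : ℕ}

lemma two_lt_critExp (N : ℕ) [hN : Fact (3 ≤ N)] : 2 < critExp N := by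
  have h3 : (3 : ℝ) ≤ N := by exact_mod_cast hN.out
  rw [critExp, lt_div_iff₀ (by linarith)]
  linarith

lemma ofReal_critExp_ne_zero (N : ℕ) [Fact (3 ≤ N)] : ENNReal.ofReal (critExp N) ≠ 0 := by
  have := two_lt_critExp N
  simp only [ne_eq, ENNReal.ofReal_eq_zero, not_le]
  linarith

lemma one_le_ofReal_critExp (N : ℕ) [Fact (3 ≤ N)] : 1 ≤ ENNReal.ofReal (critExp N) := by
  have := two_lt_critExp N
  rw [← ENNReal.ofReal_one]
  exact ENNReal.ofReal_le_ofReal (by linarith)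

/-- An approximating sequence that also converges almost everywhere. -/
lemma HasD12Grad.exists_seq_ae [Fact (3 ≤ N)] {u : RN N → ℝ} {G : RN N → RN N}
    (hu : HasD12Grad u G) :
    ∃ w : ℕ → RN N → ℝ, (∀ n, ContDiff ℝ ∞ (w n) ∧ HasCompactSupport (w n)) ∧
      (∀ᵐ x, Tendsto (fun n => w n x) atTop (𝓝 (u x))) ∧
      Tendsto (fun n => eLpNorm (gradient (w n) - G) 2) atTop (𝓝 0) := by
  obtain ⟨hu1, -, w, hw, hwu, hwG⟩ := hu
  have hmeas := tendstoInMeasure_of_tendsto_eLpNorm (ofReal_critExp_ne_zero N)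
    (fun n => (hw n).1.continuous.aestronglyMeasurable) hu1.1 hwu
  obtain ⟨ns, hns, hlim⟩ := hmeas.exists_seq_tendsto_ae
  exact ⟨fun n => w (ns n), fun n => hw (ns n), hlim, hwG.comp hns.tendsto_atTop⟩

/-- The pointwise form of Picone's inequality, from `|w - c t g|² ≥ 0`. It is applied with `g = ∇v`,
`w = ∇φ`, `c = φ` and `t = 1 / (v + ε)`. -/
lemma two_mul_inner_sub_le {g w : RN N} {t c : ℝ} :
    -(c * t) ^ 2 * ‖g‖ ^ 2 + 2 * (c * t) * ⟪g, w⟫ ≤ ‖w‖ ^ 2 := by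
  have h := sq_nonneg ‖w - (c * t) • g‖
  rw [norm_sub_sq_real, inner_smul_right, norm_smul, mul_pow, Real.norm_eq_abs, sq_abs,
    real_inner_comm] at h
  linarith

lemma IsTestFunction.integrable_polePotential_mul [Fact (3 ≤ N)] {h : Sph N → ℝ}
    (hh : Continuous h) {a : RN N} {u φ : RN N → ℝ}
    (hu : MemLp u (ENNReal.ofReal (critExp N))) (hφ : IsTestFunction {a} φ) :
    Integrable fun x => polePotential h a x * u x * φ x ^ 2 := by
  have hloc : LocallyIntegrable u := hu.locallyIntegrable (one_le_ofReal_critExp N)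
  have hc : Continuous fun x => polePotential h a x * φ x ^ 2 := by
    refine continuous_mul_of_disjoint_tsupport isClosed_singleton
      (continuousOn_polePotential hh a) (hφ.contDiff.continuous.pow 2) ?_
    rw [tsupport_sq]
    exact hφ.disjoint
  have hcs : HasCompactSupport fun x => polePotential h a x * φ x ^ 2 := by
    refine HasCompactSupport.mul_left ?_
    rw [HasCompactSupport, tsupport_sq]
    exact hφ.hasCompactSupport
  refine (hloc.integrable_smul_left_of_hasCompactSupport hc hcs).congr (.of_forall fun x => ?_)
  simp only [smul_eq_mul]
  ring

/-- Where `u ≤ 1` the integrand is at most `φ²`; elsewhere the power `2^* - 1` is dominated by the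
integrable power `2^*`. -/
lemma integrable_rpow_mul_sq [Fact (3 ≤ N)] {u φ : RN N → ℝ}
    (hu : MemLp u (ENNReal.ofReal (critExp N))) (hpos : ∀ᵐ x, 0 < u x)
    (hφ : Continuous φ) (hφc : HasCompactSupport φ) :
    Integrable fun x => u x ^ (critExp N - 1) * φ x ^ 2 := by
  have hp := two_lt_critExp N
  have hup : Integrable fun x => ‖u x‖ ^ critExp N := by
    have := hu.integrable_norm_rpow (ofReal_critExp_ne_zero N) ENNReal.ofReal_ne_top
    rwa [ENNReal.toReal_ofReal (by linarith)] at this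
  have hφ2 : Integrable fun x => φ x ^ 2 :=
    (hφ.pow 2).integrable_of_hasCompactSupport (by
      rw [HasCompactSupport, show φ ^ 2 = fun x => φ x ^ 2 from rfl, tsupport_sq]
      exact hφc)
  obtain ⟨C, hC⟩ := hφc.exists_bound_of_continuous hφ
  have hbd : Integrable fun x => φ x ^ 2 + C ^ 2 * ‖u x‖ ^ critExp N := hφ2.add (hup.const_mul _)
  refine hbd.mono' ((hu.1.aemeasurable.pow_const _).aestronglyMeasurable.mul
    (hφ.pow 2).aestronglyMeasurable) ?_
  filter_upwards [hpos] with x hx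
  have h1 : 0 ≤ u x ^ (critExp N - 1) := Real.rpow_nonneg hx.le _
  rw [Real.norm_of_nonneg (mul_nonneg h1 (sq_nonneg _)), Real.norm_of_nonneg hx.le]
  have h2 : φ x ^ 2 ≤ C ^ 2 := by
    have := hC x
    rw [← sq_abs]
    exact pow_le_pow_left₀ (abs_nonneg _) this 2
  have h0 : 0 ≤ u x ^ critExp N := Real.rpow_nonneg hx.le _
  rcases le_total (u x) 1 with h | h
  · have h3 : u x ^ (critExp N - 1) ≤ 1 := Real.rpow_le_one hx.le h (by linarith)
    have h4 : 0 ≤ C ^ 2 * u x ^ critExp N := mul_nonneg (sq_nonneg _) h0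
    nlinarith [sq_nonneg (φ x)]
  · have h3 : u x ^ (critExp N - 1) ≤ u x ^ critExp N :=
      Real.rpow_le_rpow_of_exponent_le h (by linarith)
    nlinarith [sq_nonneg (φ x)]

variable [Fact (3 ≤ N)] {k : ℕ} {h : Fin k → Sph N → ℝ} {a : Fin k → RN N} {v : RN N → ℝ}

/-- Testing the equation with `φ² / (v + ε)`. -/
lemma IsPositiveD12Solution.integral_le_of_pos (hh : ∀ i, Continuous (h i))
    (hv : IsPositiveD12Solution h a v) {ε : ℝ} (hε : 0 < ε) {φ : RN N → ℝ}
    (hφ : IsTestFunction (Set.range a) φ) :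
    (∫ x, v x ^ (critExp N - 1) * φ x ^ 2 * (v x + ε)⁻¹) +
        ∑ i, ∫ x, polePotential (h i) (a i) x * v x * φ x ^ 2 * (v x + ε)⁻¹ ≤
      ∫ x, ‖gradient φ x‖ ^ 2 := by
  obtain ⟨hpos, G, hvG, hweak⟩ := hv
  obtain ⟨w, hw, hwv, hwG⟩ := hvG.exists_seq_ae
  obtain ⟨q, C, hq, hqC, hqC', hqeq⟩ := exists_smooth_inv_add hε
  have hG : MemLp G 2 := hvG.2.1
  have hvm : AEStronglyMeasurable v := hvG.1.1
  have hφd : Differentiable ℝ φ := hφ.contDiff.differentiable (by simp)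
  have hφ1 : ContDiff ℝ 1 φ := hφ.contDiff.of_le (by simp)
  have hwd : ∀ n, Differentiable ℝ (w n) := fun n => (hw n).1.differentiable (by simp)
  have hC0 : 0 ≤ C := (abs_nonneg _).trans (hqC 0)
  obtain ⟨B, hB⟩ := hφ.hasCompactSupport.exists_bound_of_continuous hφ.contDiff.continuous
  have hB0 : 0 ≤ B := (norm_nonneg _).trans (hB 0)
  have hqm : ∀ {f : RN N → ℝ}, AEStronglyMeasurable f → AEStronglyMeasurable fun x => q (f x) :=
    fun hf => hq.continuous.comp_aestronglyMeasurable hf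
  have hqm' : ∀ {f : RN N → ℝ}, AEStronglyMeasurable f →
      AEStronglyMeasurable fun x => deriv q (f x) :=
    fun hf => (hq.continuous_deriv (by simp)).comp_aestronglyMeasurable hf
  have hwm : ∀ n, AEStronglyMeasurable (w n) := fun n => (hw n).1.continuous.aestronglyMeasurable
  have hφm : AEStronglyMeasurable φ := hφ.contDiff.continuous.aestronglyMeasurable
  -- the test functions
  let T : ℕ → RN N → ℝ := fun n x => (φ x * q (w n x)) * φ x
  have hT : ∀ n, IsTestFunction (Set.range a) (T n) := fun n =>
    hφ.mul_left (hφ.contDiff.mul (hq.comp (hw n).1))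
  have hTgrad : ∀ n x, gradient (T n) x = (φ x ^ 2 * deriv q (w n x)) • gradient (w n) x +
      (2 * φ x * q (w n x)) • gradient φ x := by
    intro n x
    have hqw : DifferentiableAt ℝ (fun y => q (w n y)) x :=
      (hq.differentiable (by simp) _).comp x (hwd n x)
    simp only [T]
    rw [gradient_mul (f := fun y => φ y * q (w n y)) ((hφd x).mul hqw) (hφd x),
      gradient_mul (f := φ) (hφd x) hqw,
      gradient_scomp (hq.differentiable (by simp) _) (hwd n x)]
    simp only [smul_add, smul_smul]
    module
  -- the coefficients
  have c1b : ∀ n x, |φ x ^ 2 * deriv q (w n x)| ≤ B ^ 2 * C := by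
    intro n x
    rw [abs_mul, abs_pow]
    exact mul_le_mul (pow_le_pow_left₀ (abs_nonneg _) (hB x) 2) (hqC' _) (abs_nonneg _)
      (sq_nonneg _)
  have c2b : ∀ n x, |2 * φ x * q (w n x)| ≤ 2 * B * C := by
    intro n x
    rw [abs_mul, abs_mul, abs_two]
    have := hB x
    rw [Real.norm_eq_abs] at this
    exact mul_le_mul (by linarith) (hqC _) (abs_nonneg _) (by positivity)
  have hwG2 : ∀ n, MemLp (gradient (w n)) 2 := fun n =>
    memLp_gradient ((hw n).1.of_le (by simp)) (hw n).2 2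
  have hgφ : MemLp (gradient φ) 2 := memLp_gradient hφ1 hφ.hasCompactSupport 2
  have hqlim : ∀ᵐ x, Tendsto (fun n => q (w n x)) atTop (𝓝 (q (v x))) := by
    filter_upwards [hwv] with x hx
    exact (hq.continuous.tendsto _).comp hx
  have hqlim' : ∀ᵐ x, Tendsto (fun n => deriv q (w n x)) atTop (𝓝 (deriv q (v x))) := by
    filter_upwards [hwv] with x hx
    exact ((hq.continuous_deriv (by simp)).tendsto _).comp hx
  have m1 : ∀ {f : RN N → ℝ}, AEStronglyMeasurable f →
      AEStronglyMeasurable fun x => φ x ^ 2 * deriv q (f x) := fun hf => (hφm.pow 2).mul (hqm' hf)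
  have m2 : ∀ {f : RN N → ℝ}, AEStronglyMeasurable f →
      AEStronglyMeasurable fun x => 2 * φ x * q (f x) := fun hf => (hφm.const_mul 2).mul (hqm hf)
  have L1 : ∀ f : RN N → ℝ, AEStronglyMeasurable f →
      MemLp (fun x => (φ x ^ 2 * deriv q (f x)) • G x) 2 := fun f hf => by
    refine MemLp.of_le_mul (c := B ^ 2 * C) hG ((m1 hf).smul hG.1) (.of_forall fun x => ?_)
    rw [norm_smul, Real.norm_eq_abs, abs_mul, abs_pow]
    refine mul_le_mul_of_nonneg_right ?_ (norm_nonneg _)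
    exact mul_le_mul (pow_le_pow_left₀ (abs_nonneg _) (hB x) 2) (hqC' _) (abs_nonneg _)
      (sq_nonneg _)
  have L2 : ∀ f : RN N → ℝ, AEStronglyMeasurable f →
      MemLp (fun x => (2 * φ x * q (f x)) • G x) 2 := fun f hf => by
    refine MemLp.of_le_mul (c := 2 * B * C) hG ((m2 hf).smul hG.1) (.of_forall fun x => ?_)
    rw [norm_smul, Real.norm_eq_abs, abs_mul, abs_mul, abs_two]
    refine mul_le_mul_of_nonneg_right ?_ (norm_nonneg _)
    have := hB x
    rw [Real.norm_eq_abs] at this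
    exact mul_le_mul (by linarith) (hqC _) (abs_nonneg _) (by positivity)
  -- The coefficients are bounded but converge only almost everywhere. They are therefore attached
  -- to the fixed field `G`, where dominated convergence gives strong `L²` limits, and paired with
  -- the strongly convergent gradients of `w n`.
  have lim1 := tendsto_integral_inner_of_tendsto_eLpNorm (fun n => L1 (w n) (hwm n)) hwG2
    (L1 v hvm) hG
    (tendsto_eLpNorm_smul_sub (fun n => m1 (hwm n)) (m1 hvm) c1b
      (by filter_upwards [hqlim'] with x hx using hx.const_mul _) hG) hwG
  have lim2 := tendsto_integral_inner_of_tendsto_eLpNorm (fun n => L2 (w n) (hwm n))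
    (fun _ => hgφ) (L2 v hvm) hgφ
    (tendsto_eLpNorm_smul_sub (fun n => m2 (hwm n)) (m2 hvm) c2b
      (by filter_upwards [hqlim] with x hx using hx.const_mul _) hG) (by simp)
  have lim3 : ∀ {f : RN N → ℝ}, Integrable f →
      Tendsto (fun n => ∫ x, f x * q (w n x)) atTop (𝓝 (∫ x, f x * q (v x))) := by
    intro f hf
    refine tendsto_integral_of_dominated_convergence (fun x => |f x| * C)
      (fun n => hf.1.mul (hqm (hwm n))) (hf.abs.mul_const C) (fun n => .of_forall fun x => ?_) ?_
    · rw [norm_mul, Real.norm_eq_abs, Real.norm_eq_abs]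
      exact mul_le_mul_of_nonneg_left (hqC _) (abs_nonneg _)
    · filter_upwards [hqlim] with x hx using hx.const_mul _
  have hinteg3 : ∀ i, Integrable fun x => polePotential (h i) (a i) x * v x * φ x ^ 2 := fun i =>
    (hφ.mono (by simp)).integrable_polePotential_mul (hh i) hvG.1
  have hinteg4 := integrable_rpow_mul_sq hvG.1 hpos hφ.contDiff.continuous hφ.hasCompactSupport
  have hI1 : ∀ f : RN N → ℝ, AEStronglyMeasurable f → ∀ g : RN N → RN N, MemLp g 2 →
      Integrable fun x => ⟪(φ x ^ 2 * deriv q (f x)) • G x, g x⟫ := fun f hf g hg =>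
    MemLp.integrable_inner_two (L1 f hf) hg
  have hI2 : ∀ f : RN N → ℝ, AEStronglyMeasurable f →
      Integrable fun x => ⟪(2 * φ x * q (f x)) • G x, gradient φ x⟫ := fun f hf =>
    MemLp.integrable_inner_two (L2 f hf) hgφ
  -- The equation for `v` is used exactly, and only the test function is approximated. The gradient
  -- of `v` is thus `G` throughout, while `w n` enters through `φ² q(w n)`.
  have hlhs : ∀ n, (∫ x, ⟪(φ x ^ 2 * deriv q (w n x)) • G x, gradient (w n) x⟫) +
      (∫ x, ⟪(2 * φ x * q (w n x)) • G x, gradient φ x⟫) -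
      ∑ i, ∫ x, polePotential (h i) (a i) x * v x * φ x ^ 2 * q (w n x) =
      ∫ x, v x ^ (critExp N - 1) * φ x ^ 2 * q (w n x) := by
    intro n
    have := hweak (T n) (hT n).contDiff (hT n).hasCompactSupport (hT n).disjoint
    rw [← integral_add (hI1 _ (hwm n) _ (hwG2 n)) (hI2 _ (hwm n))]
    convert this using 2
    · congr 1
      ext x
      rw [hTgrad]
      simp only [inner_add_right, inner_smul_left, inner_smul_right, conj_trivial]
    · congr 1
      ext i
      congr 1
      ext x
      simp only [T]
      ring
    · ext x
      simp only [T]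
      ring
  have hlim := tendsto_nhds_unique
    (((lim1.add lim2).sub (tendsto_finsetSum Finset.univ fun i _ => lim3 (hinteg3 i))).congr hlhs)
    (lim3 hinteg4)
  have e3 : ∀ f : RN N → ℝ, ∫ x, f x * (v x + ε)⁻¹ = ∫ x, f x * q (v x) := by
    intro f
    refine integral_congr_ae ?_
    filter_upwards [hpos] with x hx
    rw [(hqeq _ hx).1]
  simp only [e3]
  rw [← hlim, sub_add_cancel, ← integral_add (hI1 v hvm G hG) (hI2 v hvm)]
  refine integral_mono_ae ((hI1 v hvm G hG).add (hI2 v hvm))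
    (integrable_normSq_gradient hφ1 hφ.hasCompactSupport) ?_
  filter_upwards [hpos] with x hx
  obtain ⟨h1, h2⟩ := hqeq _ hx
  rw [inner_smul_left, inner_smul_left, conj_trivial, conj_trivial, real_inner_self_eq_norm_sq,
    h1, h2]
  refine le_of_eq_of_le ?_ (two_mul_inner_sub_le (g := G x) (t := (v x + ε)⁻¹) (c := φ x))
  field_simp

/-- A positive solution makes the quadratic form control the `L²` norm on superlevel sets. -/
lemma IsPositiveD12Solution.exists_lower_bound (hh : ∀ i, Continuous (h i))
    (hv : IsPositiveD12Solution h a v) {η : ℝ} (hη : 0 < η) :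
    ∃ c : ℝ, 0 < c ∧ ∀ S : Set (RN N), MeasurableSet S → (∀ᵐ x, x ∈ S → η ≤ v x) →
      ∀ φ, IsTestFunction (Set.range a) φ →
      c * (∫ x in S, φ x ^ 2) ≤ (∫ x, ‖gradient φ x‖ ^ 2) -
        ∑ i, ∫ x, polePotential (h i) (a i) x * φ x ^ 2 := by
  have hp := two_lt_critExp N
  -- The half comes from `v / (v + ε) ≥ 1 / 2` when `ε ≤ η ≤ v`, so the constant is uniform in `ε`.
  refine ⟨η ^ (critExp N - 2) / 2, by positivity, fun S hS hSv φ hφ => ?_⟩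
  obtain ⟨hpos, G, hvG, -⟩ := id hv
  set c := η ^ (critExp N - 2) / 2 with hc
  have hc0 : 0 < c := by positivity
  have hvm : AEStronglyMeasurable v := hvG.1.1
  have hV : ∀ i, Integrable fun x => polePotential (h i) (a i) x * φ x ^ 2 := fun i =>
    (hφ.mono (by simp)).integrable_mul_sq isClosed_singleton
      (continuousOn_polePotential (hh i) (a i))
  have hinteg4 := integrable_rpow_mul_sq hvG.1 hpos hφ.contDiff.continuous hφ.hasCompactSupport
  have hinvm : ∀ ε : ℝ, AEStronglyMeasurable fun x => (v x + ε)⁻¹ := fun ε =>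
    (hvm.aemeasurable.add_const ε).inv.aestronglyMeasurable
  have key : ∀ ε : ℝ, 0 < ε → ε ≤ η → c * (∫ x in S, φ x ^ 2) +
      ∑ i, ∫ x, polePotential (h i) (a i) x * φ x ^ 2 * (v x * (v x + ε)⁻¹) ≤
        ∫ x, ‖gradient φ x‖ ^ 2 := by
    intro ε hε hεη
    have h1 := hv.integral_le_of_pos hh hε hφ
    have h2 : c * (∫ x in S, φ x ^ 2) ≤ ∫ x, v x ^ (critExp N - 1) * φ x ^ 2 * (v x + ε)⁻¹ := by
      rw [← integral_indicator_mul_sq hS, ← integral_const_mul]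
      refine integral_mono_ae (hφ.integrable_indicator_mul_sq hS c) ?_ ?_
      · refine (hinteg4.mul_const ε⁻¹).mono (hinteg4.1.mul (hinvm ε)) ?_
        filter_upwards [hpos] with x hx
        rw [norm_mul, norm_mul _ ε⁻¹]
        refine mul_le_mul_of_nonneg_left ?_ (norm_nonneg _)
        rw [norm_inv, norm_inv, Real.norm_of_nonneg hε.le, Real.norm_of_nonneg (by positivity)]
        exact inv_anti₀ hε (by linarith)
      · filter_upwards [hpos, hSv] with x hx hxS
        have hnn : 0 ≤ v x ^ (critExp N - 1) * φ x ^ 2 * (v x + ε)⁻¹ :=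
          mul_nonneg (mul_nonneg (Real.rpow_nonneg hx.le _) (sq_nonneg _))
            (inv_nonneg.2 (by linarith))
        by_cases hxs : x ∈ S
        · have hvη := hxS hxs
          have h3 : v x ^ (critExp N - 1) = v x ^ (critExp N - 2) * v x := by
            rw [← Real.rpow_add_one hx.ne']
            congr 1
            ring
          have h4 : η ^ (critExp N - 2) ≤ v x ^ (critExp N - 2) :=
            Real.rpow_le_rpow hη.le hvη (by linarith)
          have h5 : (1 : ℝ) / 2 ≤ v x * (v x + ε)⁻¹ := by
            rw [← div_eq_mul_inv, div_le_div_iff₀ two_pos (by linarith)]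
            linarith
          have h6 : c ≤ v x ^ (critExp N - 2) * (v x * (v x + ε)⁻¹) := by
            rw [hc, div_eq_mul_one_div]
            exact mul_le_mul h4 h5 (by norm_num) (Real.rpow_nonneg hx.le _)
          rw [Set.indicator_of_mem hxs, Pi.one_apply, one_mul, h3]
          calc c * φ x ^ 2 ≤ v x ^ (critExp N - 2) * (v x * (v x + ε)⁻¹) * φ x ^ 2 :=
                mul_le_mul_of_nonneg_right h6 (sq_nonneg _)
            _ = _ := by ring
        · rw [Set.indicator_of_notMem hxs]
          simpa using hnn
    have h3 : ∀ i, ∫ x, polePotential (h i) (a i) x * v x * φ x ^ 2 * (v x + ε)⁻¹ =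
        ∫ x, polePotential (h i) (a i) x * φ x ^ 2 * (v x * (v x + ε)⁻¹) := fun i => by
      congr 1
      ext x
      ring
    simp only [h3] at h1
    linarith
  have hεlim : Tendsto (fun n : ℕ => η / ((n : ℝ) + 1)) atTop (𝓝 0) :=
    (tendsto_natCast_atTop_atTop.atTop_add tendsto_const_nhds).const_div_atTop η
  -- Only the potential terms still depend on `ε`. Their factor `v / (v + ε)` is at most one and
  -- tends to one because `v > 0` a.e.
  have hlim : ∀ i, Tendsto (fun n : ℕ => ∫ x, polePotential (h i) (a i) x * φ x ^ 2 *
      (v x * (v x + η / ((n : ℝ) + 1))⁻¹)) atTop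
      (𝓝 (∫ x, polePotential (h i) (a i) x * φ x ^ 2)) := by
    intro i
    refine tendsto_integral_of_dominated_convergence
      (fun x => |polePotential (h i) (a i) x * φ x ^ 2|)
      (fun n => (hV i).1.mul (hvm.mul (hinvm _))) (hV i).abs (fun n => ?_) ?_
    · filter_upwards [hpos] with x hx
      have he : 0 < η / ((n : ℝ) + 1) := by positivity
      rw [norm_mul, Real.norm_eq_abs]
      refine mul_le_of_le_one_right (abs_nonneg _) ?_
      rw [Real.norm_of_nonneg (by positivity), ← div_eq_mul_inv, div_le_one (by positivity)]
      linarith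
    · filter_upwards [hpos] with x hx
      have h1 : Tendsto (fun n : ℕ => v x * (v x + η / ((n : ℝ) + 1))⁻¹) atTop
          (𝓝 (v x * (v x + 0)⁻¹)) :=
        ((hεlim.const_add (v x)).inv₀ (by simpa using hx.ne')).const_mul _
      rw [add_zero, mul_inv_cancel₀ hx.ne'] at h1
      simpa using h1.const_mul (polePotential (h i) (a i) x * φ x ^ 2)
  have hfin := le_of_tendsto
    ((tendsto_finsetSum Finset.univ fun i _ => hlim i).const_add (c * ∫ x in S, φ x ^ 2))
    (.of_forall fun n => key (η / ((n : ℝ) + 1)) (by positivity)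
      (div_le_self hη.le (by linarith [Nat.cast_nonneg (α := ℝ) n])))
  linarith

end Solution

/-! ### Sobolev's inequality on sets of small measure -/

section Sobolev

lemma MeasureTheory.MemLp.eLpNorm_two_eq_sqrt {α F : Type*} [MeasurableSpace α] {μ : Measure α}
    [NormedAddCommGroup F] {f : α → F} (hf : MemLp f 2 μ) :
    eLpNorm f 2 μ = ENNReal.ofReal (Real.sqrt (∫ x, ‖f x‖ ^ 2 ∂μ)) := by
  rw [hf.eLpNorm_eq_integral_rpow_norm (by simp) (by simp), Real.sqrt_eq_rpow]
  simp

lemma exists_sobolev (N : ℕ) [hN : Fact (3 ≤ N)] :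
    ∃ C : NNReal, ∀ φ : RN N → ℝ, ContDiff ℝ 1 φ → HasCompactSupport φ →
      eLpNorm φ (ENNReal.ofReal (critExp N)) ≤ C * eLpNorm (gradient φ) 2 := by
  refine ⟨SNormLESNormFDerivOfEqConst ℝ (volume : Measure (RN N)) 2, fun φ hφ hφc => ?_⟩
  have h3 : (3 : ℝ) ≤ N := by exact_mod_cast hN.out
  have hp := two_lt_critExp N
  have h := eLpNorm_le_eLpNorm_fderiv_of_eq (volume : Measure (RN N)) hφ hφc (p := 2)
    (p' := (critExp N).toNNReal) (by norm_num)
    (by rw [finrank_euclideanSpace_fin]; have := hN.out; omega) (by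
      rw [Real.coe_toNNReal _ (by linarith), finrank_euclideanSpace_fin, critExp]
      have : (N : ℝ) - 2 ≠ 0 := by linarith
      push_cast
      field_simp)
  refine h.trans_eq ?_
  congr 1
  exact eLpNorm_congr_norm_ae (.of_forall fun x => (norm_gradient_eq φ x).symm)

/-- Sobolev's inequality combined with Hölder's inequality on a set of finite measure. -/
lemma exists_setIntegral_sq_le (N : ℕ) [Fact (3 ≤ N)] :
    ∃ C e : ℝ, 0 ≤ C ∧ 0 < e ∧ ∀ (A : Set (RN N)), volume A ≠ ⊤ →
      ∀ φ : RN N → ℝ, ContDiff ℝ 1 φ → HasCompactSupport φ →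
      ∫ x in A, φ x ^ 2 ≤ C * (volume.real A) ^ e * ∫ x, ‖gradient φ x‖ ^ 2 := by
  obtain ⟨C, hC⟩ := exists_sobolev N
  have hp := two_lt_critExp N
  -- The Hölder exponent; since `2^* > 2` it is positive, which makes the constant tend to zero with
  -- the measure of the set.
  set e : ℝ := 1 / 2 - 1 / critExp N with he
  have he0 : 0 < e := by
    rw [he, sub_pos]
    exact one_div_lt_one_div_of_lt two_pos hp
  refine ⟨(C : ℝ) ^ 2, 2 * e, sq_nonneg _, by positivity, fun A hA φ hφ hφc => ?_⟩
  have hφ2 : MemLp φ 2 (volume.restrict A) :=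
    (hφ.continuous.memLp_of_hasCompactSupport hφc).restrict A
  have hg2 := memLp_gradient hφ hφc 2
  have h1 := eLpNorm_le_eLpNorm_mul_rpow_measure_univ (μ := volume.restrict A) (f := φ)
    (p := 2) (q := ENNReal.ofReal (critExp N)) (by
      rw [← ENNReal.ofReal_ofNat]
      exact ENNReal.ofReal_le_ofReal hp.le) hφ2.1
  have h2 : eLpNorm φ (ENNReal.ofReal (critExp N)) (volume.restrict A) ≤
      C * eLpNorm (gradient φ) 2 :=
    (eLpNorm_mono_measure _ Measure.restrict_le_self).trans (hC φ hφ hφc)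
  have h3 := h1.trans (mul_le_mul_left h2 _)
  rw [hφ2.eLpNorm_two_eq_sqrt, hg2.eLpNorm_two_eq_sqrt, Measure.restrict_apply_univ,
    ENNReal.toReal_ofReal (by linarith), ENNReal.toReal_ofNat, ← he,
    ← ENNReal.ofReal_toReal hA, ENNReal.ofReal_rpow_of_nonneg ENNReal.toReal_nonneg he0.le,
    ← ENNReal.ofReal_coe_nnreal, ← ENNReal.ofReal_mul (by positivity),
    ← ENNReal.ofReal_mul (by positivity), ENNReal.ofReal_le_ofReal_iff (by positivity)] at h3
  have h4 := pow_le_pow_left₀ (Real.sqrt_nonneg _) h3 2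
  rw [mul_pow, mul_pow, Real.sq_sqrt (integral_nonneg fun x => sq_nonneg _),
    Real.sq_sqrt (integral_nonneg fun x => sq_nonneg _)] at h4
  simp only [Real.norm_eq_abs, sq_abs] at h4
  refine h4.trans_eq ?_
  rw [Measure.real, mul_comm 2 e, Real.rpow_mul ENNReal.toReal_nonneg, Real.rpow_two]
  ring

end Sobolev

/-! ### Coercivity on test functions -/

section Coercive

variable {N : ℕ}

/-- A positive measurable function is bounded below off a small subset of a ball. -/
lemma exists_small_sublevel {v : RN N → ℝ} (hvm : Measurable v) (hpos : ∀ᵐ x, 0 < v x) (R : ℝ)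
    {ε : ℝ} (hε : 0 < ε) :
    ∃ η : ℝ, 0 < η ∧ volume.real (closedBall (0 : RN N) R ∩ {x | v x < η}) < ε := by
  let A : ℕ → Set (RN N) := fun n => closedBall 0 R ∩ {x | v x < 1 / ((n : ℝ) + 1)}
  have hfin : ∀ n, volume (A n) ≠ ⊤ := fun n =>
    ((measure_mono Set.inter_subset_left).trans_lt measure_closedBall_lt_top).ne
  have hA : Tendsto (fun n => volume (A n)) atTop (𝓝 (volume (⋂ n, A n))) := by
    refine tendsto_measure_iInter_atTop (fun n => ?_) ?_ ⟨0, hfin 0⟩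
    · exact (measurableSet_closedBall.inter (measurableSet_lt hvm measurable_const)).nullMeasurableSet
    · intro m n hmn x hx
      have hx2 : v x < 1 / ((n : ℝ) + 1) := hx.2
      refine ⟨hx.1, hx2.trans_le ?_⟩
      exact one_div_le_one_div_of_le (by positivity) (by gcongr)
  have h0 : volume (⋂ n, A n) = 0 := by
    refine measure_mono_null (fun x hx => ?_) (ae_iff.1 hpos)
    simp only [Set.mem_iInter] at hx
    simp only [Set.mem_ofPred_eq, not_lt]
    exact ge_of_tendsto' tendsto_one_div_add_atTop_nhds_zero_nat fun n => (hx n).2.le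
  rw [h0] at hA
  have hA' : Tendsto (fun n => volume.real (A n)) atTop (𝓝 0) := by
    exact (ENNReal.tendsto_toReal ENNReal.zero_ne_top).comp hA
  obtain ⟨n, hn⟩ := (hA'.eventually_lt_const hε).exists
  exact ⟨1 / ((n : ℝ) + 1), by positivity, hn⟩

variable [Fact (3 ≤ N)] {k : ℕ} {h : Fin k → Sph N → ℝ} {a : Fin k → RN N}

/-- Coercivity of the quadratic form on test functions vanishing near the poles. -/
lemma exists_coercive_test (hh : ∀ i, Continuous (h i)) (ha : Function.Injective a)
    (hμ : ∀ i, sphereFirstEigenvalue (h i) > -((((N : ℝ) - 2) / 2) ^ 2))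
    (hμsum : sphereFirstEigenvalue (fun θ => ∑ i, h i θ) > -((((N : ℝ) - 2) / 2) ^ 2))
    {v : RN N → ℝ} (hv : IsPositiveD12Solution h a v) :
    ∃ c : ℝ, 0 < c ∧ ∀ φ, IsTestFunction (Set.range a) φ →
      c * (∫ x, ‖gradient φ x‖ ^ 2) ≤ (∫ x, ‖gradient φ x‖ ^ 2) -
        ∑ i, ∫ x, polePotential (h i) (a i) x * φ x ^ 2 := by
  obtain ⟨δ, C₀, R, hδ, hloc⟩ := exists_localized_form_bound hh ha hμ hμsum
  obtain ⟨S, e, hS0, he, hS⟩ := exists_setIntegral_sq_le N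
  -- The constant of the localized bound carries no sign, so its positive part is used.
  set C := max C₀ 0 with hC
  have hC0 : 0 ≤ C := le_max_right _ _
  obtain ⟨hpos, G, hvG, -⟩ := id hv
  -- A measurable representative makes the sublevel sets measurable.
  set v' := hvG.1.1.mk v with hv'
  have hvm : Measurable v' := hvG.1.1.stronglyMeasurable_mk.measurable
  have hvv' : v =ᵐ[volume] v' := hvG.1.1.ae_eq_mk
  have hpos' : ∀ᵐ x, 0 < v' x := by
    filter_upwards [hpos, hvv'] with x h1 h2
    rwa [← h2]
  -- the sublevel set is so small that Sobolev's inequality absorbs it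
  obtain ⟨t, ht0, ht⟩ : ∃ t : ℝ, 0 < t ∧ C * (S * t ^ e) ≤ δ / 2 := by
    have h1 : Tendsto (fun t : ℝ => C * (S * t ^ e)) (𝓝[>] 0) (𝓝 (C * (S * 0 ^ e))) :=
      (((Real.continuous_rpow_const he.le).tendsto 0).mono_left nhdsWithin_le_nhds
        |>.const_mul S).const_mul C
    rw [Real.zero_rpow he.ne', mul_zero, mul_zero] at h1
    obtain ⟨t, ht, ht0⟩ :=
      ((h1.eventually_lt_const (half_pos hδ)).and self_mem_nhdsWithin).exists
    exact ⟨t, ht0, ht.le⟩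
  obtain ⟨η, hη, hsmall⟩ := exists_small_sublevel hvm hpos' R ht0
  obtain ⟨c, hc, hlow⟩ := hv.exists_lower_bound hh hη
  set K : Set (RN N) := closedBall 0 R with hK
  set A : Set (RN N) := {x | v' x < η} with hA
  have hAm : MeasurableSet A := measurableSet_lt hvm measurable_const
  -- From `δ D ≤ Q + C ∫_K φ²`, the sublevel part of `K` costs `δ D / 2` and the rest costs `(C / c)
  -- Q`, so `(δ / 2) D ≤ (1 + C / c) Q`.
  refine ⟨(δ / 2) / (1 + C / c), by positivity, fun φ hφ => ?_⟩
  have hφ1 : ContDiff ℝ 1 φ := hφ.contDiff.of_le (by simp)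
  have hV : ∀ i, Integrable fun x => polePotential (h i) (a i) x * φ x ^ 2 := fun i =>
    (hφ.mono (by simp)).integrable_mul_sq isClosed_singleton
      (continuousOn_polePotential (hh i) (a i))
  have hsum : ∫ x, (∑ i, polePotential (h i) (a i) x) * φ x ^ 2 =
      ∑ i, ∫ x, polePotential (h i) (a i) x * φ x ^ 2 := by
    rw [← integral_finsetSum _ fun i _ => hV i]
    simp only [Finset.sum_mul]
  have h1 := hloc φ hφ
  rw [hsum] at h1
  have h2 := hlow (K \ A) (measurableSet_closedBall.diff hAm) (by
    filter_upwards [hvv'] with x hx hxS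
    rw [hx]
    exact not_lt.1 hxS.2) φ hφ
  have h3 := hS (K ∩ A) ((measure_mono Set.inter_subset_left).trans_lt
    measure_closedBall_lt_top).ne φ hφ1 hφ.hasCompactSupport
  have hi : Integrable fun x => φ x ^ 2 := by
    simpa using (hφ.mono (Set.empty_subset _)).integrable_mul_sq isClosed_empty
      (f := fun _ => 1) continuousOn_const
  have h4 : (∫ x in K ∩ A, φ x ^ 2) + ∫ x in K \ A, φ x ^ 2 = ∫ x in K, φ x ^ 2 :=
    integral_inter_add_sdiff hAm hi.integrableOn
  have hKnn : 0 ≤ ∫ x in K, φ x ^ 2 := integral_nonneg fun x => sq_nonneg _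
  have hD0 : 0 ≤ ∫ x, ‖gradient φ x‖ ^ 2 := integral_nonneg fun x => sq_nonneg _
  set D := ∫ x, ‖gradient φ x‖ ^ 2
  set P := ∑ i, ∫ x, polePotential (h i) (a i) x * φ x ^ 2
  have h5 : C₀ * ∫ x in K, φ x ^ 2 ≤ C * ∫ x in K, φ x ^ 2 :=
    mul_le_mul_of_nonneg_right (le_max_left _ _) hKnn
  have h6 : C * ∫ x in K ∩ A, φ x ^ 2 ≤ δ / 2 * D := by
    have h7 : (volume.real (K ∩ A)) ^ e ≤ t ^ e :=
      Real.rpow_le_rpow measureReal_nonneg hsmall.le he.le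
    calc C * ∫ x in K ∩ A, φ x ^ 2 ≤ C * (S * t ^ e * D) := by
          refine mul_le_mul_of_nonneg_left (h3.trans ?_) hC0
          gcongr
      _ = C * (S * t ^ e) * D := by ring
      _ ≤ δ / 2 * D := mul_le_mul_of_nonneg_right ht hD0
  have h8 : C * ∫ x in K \ A, φ x ^ 2 ≤ C / c * (D - P) := by
    rw [div_mul_eq_mul_div, le_div_iff₀ hc]
    calc C * (∫ x in K \ A, φ x ^ 2) * c = C * (c * ∫ x in K \ A, φ x ^ 2) := by ring
      _ ≤ C * (D - P) := mul_le_mul_of_nonneg_left h2 hC0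
  rw [← h4, mul_add] at h5
  rw [← h4] at h1
  have h9 : δ / 2 * D ≤ (1 + C / c) * (D - P) := by linarith
  rw [div_mul_eq_mul_div, div_le_iff₀ (by positivity)]
  linarith

end Coercive

/-! ### Density of functions vanishing near finitely many points -/

section Density

variable {N : ℕ} [hN : Fact (3 ≤ N)]

/-- Removing a small neighbourhood of a point changes the gradient little in `L²`. -/
lemma IsTestFunction.exists_insert {s : Set (RN N)} {φ : RN N → ℝ} (hφ : IsTestFunction s φ)
    (a : RN N) {ε : ℝ} (hε : 0 < ε) :
    ∃ ψ, IsTestFunction (insert a s) ψ ∧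
      eLpNorm (gradient ψ - gradient φ) 2 ≤ ENNReal.ofReal ε := by
  have := nontrivial_RN N
  have hφd : Differentiable ℝ φ := hφ.contDiff.differentiable (by simp)
  let ζ : ContDiffBump (0 : RN N) := ⟨1 / 2, 1, by norm_num, by norm_num⟩
  have hζ : ContDiff ℝ ∞ ζ := ζ.contDiff
  obtain ⟨L, hL⟩ := ζ.hasCompactSupport.gradient.exists_bound_of_continuous
    (continuous_gradient (hζ.of_le (by simp)))
  obtain ⟨B, hB⟩ := hφ.hasCompactSupport.exists_bound_of_continuous hφ.contDiff.continuous
  obtain ⟨B', hB'⟩ := hφ.hasCompactSupport.gradient.exists_bound_of_continuous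
    (continuous_gradient (hφ.contDiff.of_le (by simp)))
  have hL0 : 0 ≤ L := (norm_nonneg _).trans (hL 0)
  have hB0 : 0 ≤ B := (norm_nonneg _).trans (hB 0)
  have hB0' : 0 ≤ B' := (norm_nonneg _).trans (hB' 0)
  set M := B' + B * L with hM
  set V := volume.real (ball (0 : RN N) 1) with hV
  -- A cutoff at scale `t` contributes a gradient of size at most `M / t` on a ball of volume `V
  -- t^N`. Its squared `L²` norm is at most `M² V t` when `t < 1` and `N ≥ 3`.
  obtain ⟨t, ⟨ht, ht1⟩, ht0⟩ : ∃ t : ℝ, (M ^ 2 * V * t < ε ^ 2 ∧ t < 1) ∧ 0 < t := by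
    have h1 : Tendsto (fun t : ℝ => M ^ 2 * V * t) (𝓝[>] 0) (𝓝 (M ^ 2 * V * 0)) :=
      (tendsto_id.const_mul _).mono_left nhdsWithin_le_nhds
    rw [mul_zero] at h1
    have h2 : ∀ᶠ t in 𝓝[>] (0 : ℝ), t < 1 := by
      filter_upwards [Ioo_mem_nhdsGT one_pos] with t ht using ht.2
    exact (((h1.eventually_lt_const (by positivity)).and h2).and self_mem_nhdsWithin).exists
  let z : RN N → ℝ := fun x => ζ (t⁻¹ • (x - a))
  have hz : ContDiff ℝ ∞ z := hζ.comp ((contDiff_id.sub contDiff_const).const_smul t⁻¹)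
  have hzd : Differentiable ℝ z := hz.differentiable (by simp)
  have hzgrad : ∀ x, gradient z x = t⁻¹ • gradient ζ (t⁻¹ • (x - a)) := by
    intro x
    have h1 : HasFDerivAt (fun y : RN N => t⁻¹ • (y - a)) (t⁻¹ • ContinuousLinearMap.id ℝ (RN N)) x :=
      ((hasFDerivAt_id x).sub_const a).const_smul t⁻¹
    have h2 := ((hζ.differentiable (by simp)) (t⁻¹ • (x - a))).hasFDerivAt.comp x h1
    refine ext_inner_right ℝ fun y => ?_
    rw [inner_gradient_left, inner_smul_left, inner_gradient_left]
    have h3 : fderiv ℝ z x = _ := h2.fderiv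
    rw [h3]
    simp
  have hz0 : ∀ x, x ∉ closedBall a t → z x = 0 := by
    intro x hx
    refine ζ.zero_of_le_dist ?_
    rw [mem_closedBall, dist_eq_norm, not_le] at hx
    rw [dist_zero_right, norm_smul, norm_inv, Real.norm_of_nonneg ht0.le]
    change (1 : ℝ) ≤ _
    rw [← div_eq_inv_mul, le_div_iff₀ ht0]
    linarith
  have hznear : z =ᶠ[𝓝 a] fun _ => 1 := by
    filter_upwards [ball_mem_nhds a (by positivity : 0 < t / 2)] with x hx
    refine ζ.one_of_mem_closedBall ?_
    rw [mem_ball, dist_eq_norm] at hx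
    rw [mem_closedBall, dist_zero_right, norm_smul, norm_inv, Real.norm_of_nonneg ht0.le]
    change _ ≤ (1 / 2 : ℝ)
    rw [← div_eq_inv_mul, div_le_iff₀ ht0]
    linarith
  let ψ : RN N → ℝ := fun x => (1 - z x) * φ x
  have hψs : IsTestFunction s ψ := hφ.mul_left (contDiff_const.sub hz)
  have hzφ : IsTestFunction s (fun x => z x * φ x) := hφ.mul_left hz
  refine ⟨ψ, ⟨hψs.contDiff, hψs.hasCompactSupport, ?_⟩, ?_⟩
  · rw [Set.disjoint_insert_right]
    refine ⟨?_, hψs.disjoint⟩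
    rw [notMem_tsupport_iff_eventuallyEq]
    filter_upwards [hznear] with x hx
    simp [ψ, hx]
  · have hdiff : ∀ x, (gradient ψ - gradient φ) x = -gradient (fun y => z y * φ y) x := by
      intro x
      have h1 : ψ = fun y => φ y - z y * φ y := by
        ext y
        simp only [ψ]
        ring
      rw [Pi.sub_apply, h1, gradient_sub (g := fun y => z y * φ y) (hφd x) ((hzd x).mul (hφd x))]
      simp
    have hnorm : eLpNorm (gradient ψ - gradient φ) 2 =
        eLpNorm (gradient fun y => z y * φ y) 2 :=
      eLpNorm_congr_norm_ae (.of_forall fun x => by rw [hdiff, norm_neg])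
    have hsup : ∀ x, x ∉ closedBall a t → gradient (fun y => z y * φ y) x = 0 := by
      intro x hx
      have h1 : (fun y => z y * φ y) =ᶠ[𝓝 x] fun _ => 0 := by
        filter_upwards [isClosed_closedBall.isOpen_compl.mem_nhds hx] with y hy
        simp [hz0 y hy]
      rw [h1.gradient_eq, gradient_fun_const]
    have hbd : ∀ x, ‖gradient (fun y => z y * φ y) x‖ ≤ M * t⁻¹ := by
      intro x
      rw [gradient_mul (hzd x) (hφd x), hzgrad]
      refine (norm_add_le _ _).trans ?_
      rw [norm_smul, norm_smul, norm_smul, norm_inv, Real.norm_of_nonneg ht0.le]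
      have h1 : ‖z x‖ ≤ 1 := by
        rw [Real.norm_of_nonneg ζ.nonneg]
        exact ζ.le_one
      have h2 : (1 : ℝ) ≤ t⁻¹ := (one_le_inv₀ ht0).2 ht1.le
      calc ‖z x‖ * ‖gradient φ x‖ + ‖φ x‖ * (t⁻¹ * ‖gradient ζ (t⁻¹ • (x - a))‖)
          ≤ 1 * B' + B * (t⁻¹ * L) := by
            gcongr
            exacts [hB' x, hB x, hL _]
        _ ≤ t⁻¹ * B' + B * (t⁻¹ * L) := by gcongr
        _ = M * t⁻¹ := by rw [hM]; ring
    have hmem := memLp_gradient (hzφ.contDiff.of_le (by simp)) hzφ.hasCompactSupport 2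
    rw [hnorm, hmem.eLpNorm_two_eq_sqrt]
    refine ENNReal.ofReal_le_ofReal (Real.sqrt_le_iff.2 ⟨hε.le, ?_⟩)
    have hvol : volume.real (closedBall a t) = t ^ N * V := by
      rw [Measure.real, Measure.addHaar_closedBall _ _ ht0.le, ENNReal.toReal_mul,
        ENNReal.toReal_ofReal (by positivity), finrank_euclideanSpace_fin]
      rfl
    have hinteg : ∫ x, ‖gradient (fun y => z y * φ y) x‖ ^ 2 ≤
        (M * t⁻¹) ^ 2 * volume.real (closedBall a t) := by
      rw [← setIntegral_eq_integral_of_forall_compl_eq_zero (s := closedBall a t)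
        fun x hx => by simp [hsup x hx]]
      refine (Real.le_norm_self _).trans (norm_setIntegral_le_of_norm_le_const
        measure_closedBall_lt_top fun x _ => ?_)
      rw [norm_pow, norm_norm]
      exact pow_le_pow_left₀ (norm_nonneg _) (hbd x) 2
    refine hinteg.trans (le_trans ?_ ht.le)
    rw [hvol]
    have h3 : t ^ N ≤ t ^ 3 := pow_le_pow_of_le_one ht0.le ht1.le hN.out
    have hV0 : 0 ≤ V := measureReal_nonneg
    calc (M * t⁻¹) ^ 2 * (t ^ N * V) ≤ (M * t⁻¹) ^ 2 * (t ^ 3 * V) := by gcongr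
      _ = M ^ 2 * V * t := by field_simp

/-- Test functions vanishing near a finite set are dense in the Dirichlet seminorm. -/
lemma exists_testFunction_near {s : Set (RN N)} (hs : s.Finite) {φ : RN N → ℝ}
    (hφ : ContDiff ℝ ∞ φ) (hφc : HasCompactSupport φ) {ε : ℝ} (hε : 0 < ε) :
    ∃ ψ, IsTestFunction s ψ ∧ eLpNorm (gradient ψ - gradient φ) 2 ≤ ENNReal.ofReal ε := by
  induction s, hs using Set.Finite.induction_on generalizing ε with
  | empty => exact ⟨φ, ⟨hφ, hφc, Set.disjoint_empty _⟩, by simp⟩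
  | @insert a s _ _ ih =>
    obtain ⟨ψ₀, hψ₀, h₀⟩ := ih (half_pos hε)
    obtain ⟨ψ, hψ, h₁⟩ := hψ₀.exists_insert a (half_pos hε)
    refine ⟨ψ, hψ, ?_⟩
    have hm : ∀ {f : RN N → ℝ}, ContDiff ℝ ∞ f → AEStronglyMeasurable (gradient f) := fun hf =>
      (continuous_gradient (hf.of_le (by simp))).aestronglyMeasurable
    refine (eLpNorm_sub_le_add (hm hψ.contDiff) (hm hψ₀.contDiff) (hm hφ) one_le_two).trans
      ((add_le_add h₁ h₀).trans_eq ?_)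
    rw [← ENNReal.ofReal_add (by positivity) (by positivity), add_halves]

/-- Elements of `𝒟^{1,2}` are limits of test functions vanishing near a finite set. -/
lemma HasD12Grad.exists_seq_test {s : Set (RN N)} (hs : s.Finite) {u : RN N → ℝ}
    {G : RN N → RN N} (hu : HasD12Grad u G) :
    ∃ ψ : ℕ → RN N → ℝ, (∀ n, IsTestFunction s (ψ n)) ∧
      Tendsto (fun n => eLpNorm (ψ n - u) (ENNReal.ofReal (critExp N))) atTop (𝓝 0) ∧
      Tendsto (fun n => eLpNorm (gradient (ψ n) - G) 2) atTop (𝓝 0) := by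
  obtain ⟨hu1, hG, w, hw, hwu, hwG⟩ := hu
  obtain ⟨C, hC⟩ := exists_sobolev N
  have hex : ∀ n : ℕ, ∃ ψ, IsTestFunction s ψ ∧
      eLpNorm (gradient ψ - gradient (w n)) 2 ≤ ENNReal.ofReal (1 / ((n : ℝ) + 1)) := fun n =>
    exists_testFunction_near hs (hw n).1 (hw n).2 (by positivity)
  choose ψ hψ hψw using hex
  have hm : ∀ {f : RN N → ℝ}, ContDiff ℝ ∞ f → AEStronglyMeasurable (gradient f) := fun hf =>
    (continuous_gradient (hf.of_le (by simp))).aestronglyMeasurable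
  have h0 : Tendsto (fun n : ℕ => ENNReal.ofReal (1 / ((n : ℝ) + 1))) atTop (𝓝 0) := by
    simpa using ENNReal.tendsto_ofReal tendsto_one_div_add_atTop_nhds_zero_nat
  have h1 : Tendsto (fun n => eLpNorm (gradient (ψ n) - gradient (w n)) 2) atTop (𝓝 0) :=
    tendsto_of_tendsto_of_tendsto_of_le_of_le tendsto_const_nhds h0 (fun _ => zero_le) hψw
  have h2 : ∀ n, eLpNorm (ψ n - w n) (ENNReal.ofReal (critExp N)) ≤
      C * eLpNorm (gradient (ψ n) - gradient (w n)) 2 := by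
    intro n
    have h3 := hC (fun x => ψ n x - w n x)
      (((hψ n).contDiff.sub (hw n).1).of_le (by simp))
      ((hψ n).hasCompactSupport.sub (hw n).2)
    have h4 : gradient (fun x => ψ n x - w n x) = gradient (ψ n) - gradient (w n) :=
      funext fun x => gradient_sub ((hψ n).contDiff.differentiable (by simp) x)
        ((hw n).1.differentiable (by simp) x)
    rwa [h4] at h3
  have h5 : Tendsto (fun n => (C : ENNReal) * eLpNorm (gradient (ψ n) - gradient (w n)) 2)
      atTop (𝓝 0) := by
    simpa using ENNReal.Tendsto.const_mul h1 (.inr ENNReal.coe_ne_top)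
  refine ⟨ψ, hψ, ?_, ?_⟩
  · have h6 := h5.add hwu
    rw [add_zero] at h6
    refine tendsto_of_tendsto_of_tendsto_of_le_of_le tendsto_const_nhds h6 (fun _ => zero_le)
      fun n => ?_
    exact (eLpNorm_sub_le_add (hψ n).contDiff.continuous.aestronglyMeasurable
      (hw n).1.continuous.aestronglyMeasurable hu1.1 (one_le_ofReal_critExp N)).trans
      (add_le_add (h2 n) le_rfl)
  · have h6 := h1.add hwG
    rw [add_zero] at h6
    refine tendsto_of_tendsto_of_tendsto_of_le_of_le tendsto_const_nhds h6 (fun _ => zero_le)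
      fun n => ?_
    exact eLpNorm_sub_le_add (hm (hψ n).contDiff) (hm (hw n).1) hG.1 one_le_two

/-- Sobolev's inequality in `𝒟^{1,2}`: a function with zero gradient vanishes. -/
lemma HasD12Grad.ae_eq_zero {u : RN N → ℝ} {G : RN N → RN N} (hu : HasD12Grad u G)
    (hG0 : ∫ x, ‖G x‖ ^ 2 = 0) : u =ᵐ[volume] 0 := by
  obtain ⟨hu1, hG, w, hw, hwu, hwG⟩ := hu
  obtain ⟨C, hC⟩ := exists_sobolev N
  have hGz : eLpNorm G 2 = 0 := by
    rw [hG.eLpNorm_two_eq_sqrt, hG0]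
    simp
  have h1 : Tendsto (fun n => eLpNorm (w n - u) (ENNReal.ofReal (critExp N)) +
      C * (eLpNorm (gradient (w n) - G) 2 + eLpNorm G 2)) atTop (𝓝 0) := by
    rw [hGz]
    have := hwu.add (ENNReal.Tendsto.const_mul (hwG.add_const 0) (.inr (ENNReal.coe_ne_top (r := C))))
    simpa using this
  have h2 : ∀ n, eLpNorm u (ENNReal.ofReal (critExp N)) ≤
      eLpNorm (w n - u) (ENNReal.ofReal (critExp N)) +
      C * (eLpNorm (gradient (w n) - G) 2 + eLpNorm G 2) := by
    intro n
    have hwm := (hw n).1.continuous.aestronglyMeasurable (μ := (volume : Measure (RN N)))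
    have hgm := (continuous_gradient ((hw n).1.of_le (by simp))).aestronglyMeasurable
      (μ := (volume : Measure (RN N)))
    have h3 := eLpNorm_sub_le_add hu1.1 hwm (aestronglyMeasurable_zero (μ := volume))
      (one_le_ofReal_critExp N)
    have h4 := eLpNorm_sub_le_add hgm hG.1 (aestronglyMeasurable_zero (μ := volume)) one_le_two
    rw [sub_zero, sub_zero] at h3 h4
    rw [eLpNorm_sub_comm] at h3
    refine h3.trans (add_le_add le_rfl ?_)
    exact (hC (w n) ((hw n).1.of_le (by simp)) (hw n).2).trans (mul_le_mul_right h4 _)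
  have h3 : eLpNorm u (ENNReal.ofReal (critExp N)) = 0 :=
    le_antisymm (ge_of_tendsto' h1 h2) (zero_le)
  exact (eLpNorm_eq_zero_iff hu1.1 (ofReal_critExp_ne_zero N)).1 h3

end Density

/-! ### Passing to the limit in the potential terms -/

section HardyLimit

variable {N : ℕ} [hN : Fact (3 ≤ N)]

/-- Hardy's inequality in terms of `L²` norms. -/
lemma exists_hardy_eLpNorm (a : RN N) :
    ∃ C : NNReal, ∀ φ : RN N → ℝ, IsTestFunction {a} φ →
      MemLp (fun x => ‖x - a‖⁻¹ * φ x) 2 ∧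
      eLpNorm (fun x => ‖x - a‖⁻¹ * φ x) 2 ≤ C * eLpNorm (gradient φ) 2 := by
  have h3 : (3 : ℝ) ≤ N := by exact_mod_cast hN.out
  set c : ℝ := ((N : ℝ) - 2) / 2 with hc
  have hc0 : 0 < c := by rw [hc]; linarith
  refine ⟨(c⁻¹).toNNReal, fun φ hφ => ?_⟩
  have hsq : ∀ x, (‖x - a‖⁻¹ * φ x) ^ 2 = (‖x - a‖ ^ 2)⁻¹ * φ x ^ 2 := fun x => by
    rw [mul_pow, inv_pow]
  have hinteg : Integrable fun x => (‖x - a‖ ^ 2)⁻¹ * φ x ^ 2 :=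
    hφ.integrable_mul_sq isClosed_singleton (continuousOn_inv_normSq_sub a)
  have hcont : ContinuousOn (fun x : RN N => ‖x - a‖⁻¹) {a}ᶜ := by
    refine ContinuousOn.inv₀ (by fun_prop) fun x hx => ?_
    simpa [sub_eq_zero] using hx
  have hmem : MemLp (fun x => ‖x - a‖⁻¹ * φ x) 2 :=
    (continuous_mul_of_disjoint_tsupport isClosed_singleton hcont hφ.contDiff.continuous
      hφ.disjoint).memLp_of_hasCompactSupport hφ.hasCompactSupport.mul_left
  refine ⟨hmem, ?_⟩
  have hφ' := hφ.translate
  have h1 := hardy_radial hφ'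
  have h2 : ∫ x, (‖x‖ ^ 2)⁻¹ * ⟪gradient (fun y => φ (y + a)) x, x⟫ ^ 2 ≤
      ∫ x, ‖gradient (fun y => φ (y + a)) x‖ ^ 2 := by
    refine integral_mono hφ'.integrable_radial
      (integrable_normSq_gradient (hφ'.contDiff.of_le (by simp)) hφ'.hasCompactSupport)
      fun x => ?_
    by_cases hx : x = 0
    · simp [hx]
    · have h4 := abs_real_inner_le_norm (gradient (fun y => φ (y + a)) x) x
      have h5 := pow_le_pow_left₀ (abs_nonneg _) h4 2
      rw [sq_abs, mul_pow] at h5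
      have h6 : 0 < ‖x‖ ^ 2 := by positivity
      change (‖x‖ ^ 2)⁻¹ * ⟪gradient (fun y => φ (y + a)) x, x⟫ ^ 2 ≤ _
      rw [inv_mul_le_iff₀ h6]
      linarith
  have h7 := h1.trans h2
  simp only [gradient_comp_add_right] at h7
  have e1 : ∫ x, (‖x‖ ^ 2)⁻¹ * φ (x + a) ^ 2 = ∫ x, (‖x - a‖ ^ 2)⁻¹ * φ x ^ 2 := by
    rw [← integral_add_right_eq_self (fun x => (‖x - a‖ ^ 2)⁻¹ * φ x ^ 2) a]
    simp
  rw [e1, integral_add_right_eq_self (fun x => ‖gradient φ x‖ ^ 2) a, ← hc] at h7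
  rw [hmem.eLpNorm_two_eq_sqrt,
    (memLp_gradient (hφ.contDiff.of_le (by simp)) hφ.hasCompactSupport 2).eLpNorm_two_eq_sqrt,
    ← ENNReal.ofReal_coe_nnreal, Real.coe_toNNReal _ (by positivity),
    ← ENNReal.ofReal_mul (by positivity)]
  refine ENNReal.ofReal_le_ofReal ?_
  rw [← div_eq_inv_mul, le_div_iff₀ hc0, ← Real.sqrt_sq hc0.le,
    ← Real.sqrt_mul (integral_nonneg fun x => sq_nonneg _)]
  refine Real.sqrt_le_sqrt ?_
  simp only [Real.norm_eq_abs, sq_abs, hsq]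
  linarith

lemma aestronglyMeasurable_of_continuousOn_compl_singleton {f : RN N → ℝ} {a : RN N}
    (hf : ContinuousOn f {a}ᶜ) : AEStronglyMeasurable f := by
  have := nontrivial_RN N
  rw [← restrict_compl_singleton (μ := volume) a]
  exact hf.aestronglyMeasurable (measurableSet_singleton a).compl

/-- Convergence in `𝒟^{1,2}` implies convergence in the Hardy space. -/
lemma tendsto_eLpNorm_hardy {a : RN N} {ψ : ℕ → RN N → ℝ} (hψ : ∀ n, IsTestFunction {a} (ψ n))
    {u : RN N → ℝ} {G : RN N → RN N} (hG : MemLp G 2) (hum : AEStronglyMeasurable u)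
    (hψu : ∀ᵐ x, Tendsto (fun n => ψ n x) atTop (𝓝 (u x)))
    (hψG : Tendsto (fun n => eLpNorm (gradient (ψ n) - G) 2) atTop (𝓝 0)) :
    MemLp (fun x => ‖x - a‖⁻¹ * u x) 2 ∧
    Tendsto (fun n => eLpNorm ((fun x => ‖x - a‖⁻¹ * ψ n x) - fun x => ‖x - a‖⁻¹ * u x) 2)
      atTop (𝓝 0) := by
  obtain ⟨C, hC⟩ := exists_hardy_eLpNorm a
  have hgm : ∀ n, MemLp (gradient (ψ n)) 2 := fun n =>
    memLp_gradient ((hψ n).contDiff.of_le (by simp)) (hψ n).hasCompactSupport 2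
  have hcont : ContinuousOn (fun x : RN N => ‖x - a‖⁻¹) {a}ᶜ := by
    refine ContinuousOn.inv₀ (by fun_prop) fun x hx => ?_
    simpa [sub_eq_zero] using hx
  have hwm := aestronglyMeasurable_of_continuousOn_compl_singleton hcont
  have hsub : ∀ m n, IsTestFunction {a} (fun x => ψ m x - ψ n x) := fun m n =>
    ⟨(hψ m).contDiff.sub (hψ n).contDiff, (hψ m).hasCompactSupport.sub (hψ n).hasCompactSupport, by
      rw [Set.disjoint_singleton_right, notMem_tsupport_iff_eventuallyEq]
      have h1 := notMem_tsupport_iff_eventuallyEq.1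
        (Set.disjoint_singleton_right.1 (hψ m).disjoint)
      have h2 := notMem_tsupport_iff_eventuallyEq.1
        (Set.disjoint_singleton_right.1 (hψ n).disjoint)
      filter_upwards [h1, h2] with x hx1 hx2
      simp [hx1, hx2]⟩
  have hgsub : ∀ m n, gradient (fun x => ψ m x - ψ n x) = gradient (ψ m) - gradient (ψ n) :=
    fun m n => funext fun x => gradient_sub ((hψ m).contDiff.differentiable (by simp) x)
      ((hψ n).contDiff.differentiable (by simp) x)
  -- Fatou's lemma as `m → ∞`, after applying Hardy's inequality to `ψ m - ψ n`. The case `n = 0`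
  -- also shows that the limit lies in the weighted space.
  have key : ∀ n, eLpNorm ((fun x => ‖x - a‖⁻¹ * ψ n x) - fun x => ‖x - a‖⁻¹ * u x) 2 ≤
      C * eLpNorm (gradient (ψ n) - G) 2 := by
    intro n
    rw [eLpNorm_sub_comm]
    have h1 := Lp.eLpNorm_lim_le_liminf_eLpNorm (μ := (volume : Measure (RN N))) (p := 2)
      (f := fun m x => ‖x - a‖⁻¹ * (ψ m x - ψ n x)) (fun m => (hC _ (hsub m n)).1.1)
      ((fun x => ‖x - a‖⁻¹ * u x) - fun x => ‖x - a‖⁻¹ * ψ n x) (by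
        filter_upwards [hψu] with x hx
        simp only [Pi.sub_apply, ← mul_sub]
        exact (hx.sub_const _).const_mul _)
    have h2 : ∀ m, eLpNorm (fun x => ‖x - a‖⁻¹ * (ψ m x - ψ n x)) 2 ≤
        C * (eLpNorm (gradient (ψ m) - G) 2 + eLpNorm (gradient (ψ n) - G) 2) := by
      intro m
      refine (hC _ (hsub m n)).2.trans ?_
      gcongr
      rw [hgsub, ← sub_sub_sub_cancel_right _ _ G]
      exact eLpNorm_sub_le ((hgm m).1.sub hG.1) ((hgm n).1.sub hG.1) (by norm_num)
    have h3 : Tendsto (fun m => (C : ENNReal) *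
        (eLpNorm (gradient (ψ m) - G) 2 + eLpNorm (gradient (ψ n) - G) 2)) atTop
        (𝓝 (C * (0 + eLpNorm (gradient (ψ n) - G) 2))) :=
      ENNReal.Tendsto.const_mul (hψG.add_const _) (.inr ENNReal.coe_ne_top)
    rw [zero_add] at h3
    refine h1.trans ?_
    rw [← h3.liminf_eq]
    exact liminf_le_liminf (.of_forall h2)
  have hfin : MemLp ((fun x => ‖x - a‖⁻¹ * ψ 0 x) - fun x => ‖x - a‖⁻¹ * u x) 2 :=
    ⟨(hC _ (hψ 0)).1.1.sub (hwm.mul hum), (key 0).trans_lt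
      (ENNReal.mul_lt_top ENNReal.coe_lt_top ((hgm 0).sub hG).2)⟩
  constructor
  · have := (hC _ (hψ 0)).1.sub hfin
    rwa [sub_sub_cancel] at this
  · have h4 : Tendsto (fun n => (C : ENNReal) * eLpNorm (gradient (ψ n) - G) 2) atTop (𝓝 0) := by
      simpa using ENNReal.Tendsto.const_mul hψG (.inr (ENNReal.coe_ne_top (r := C)))
    exact tendsto_of_tendsto_of_tendsto_of_le_of_le tendsto_const_nhds h4 (fun _ => zero_le) key

/-- The integrand is the product of `u / |x - a|` with itself times a bounded angular factor. Both
factors converge strongly in `L²` by Hardy's inequality, hence so does the integral of their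
product. -/
lemma tendsto_integral_polePotential {h : Sph N → ℝ} (hh : Continuous h) {a : RN N}
    {ψ : ℕ → RN N → ℝ} (hψ : ∀ n, IsTestFunction {a} (ψ n))
    {u : RN N → ℝ} {G : RN N → RN N} (hG : MemLp G 2) (hum : AEStronglyMeasurable u)
    (hψu : ∀ᵐ x, Tendsto (fun n => ψ n x) atTop (𝓝 (u x)))
    (hψG : Tendsto (fun n => eLpNorm (gradient (ψ n) - G) 2) atTop (𝓝 0)) :
    Tendsto (fun n => ∫ x, polePotential h a x * ψ n x ^ 2) atTop
      (𝓝 (∫ x, polePotential h a x * u x ^ 2)) := by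
  obtain ⟨hmem, hlim⟩ := tendsto_eLpNorm_hardy hψ hG hum hψu hψG
  obtain ⟨C, hC⟩ := exists_hardy_eLpNorm a
  obtain ⟨M, hM0, hM⟩ := exists_abs_le_of_continuous hh
  have hangm : AEStronglyMeasurable (fun x => angular h (x - a)) := by
    refine aestronglyMeasurable_of_continuousOn_compl_singleton (a := a)
      ((continuousOn_angular hh).comp (by fun_prop) fun x hx => ?_)
    simpa [sub_eq_zero] using hx
  have hb : ∀ f : RN N → ℝ, ∀ᵐ x, ‖angular h (x - a) * f x‖ ≤ M * ‖f x‖ := fun f =>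
    .of_forall fun x => by
      rw [norm_mul]
      exact mul_le_mul_of_nonneg_right (abs_angular_le hM hM0 _) (norm_nonneg _)
  have hmul : ∀ {f : RN N → ℝ}, MemLp f 2 → MemLp (fun x => angular h (x - a) * f x) 2 :=
    fun hf => MemLp.of_le_mul hf (hangm.mul hf.1) (hb _)
  have hlim' : Tendsto (fun n => eLpNorm ((fun x => angular h (x - a) * (‖x - a‖⁻¹ * ψ n x)) -
      fun x => angular h (x - a) * (‖x - a‖⁻¹ * u x)) 2) atTop (𝓝 0) := by
    have h1 : Tendsto (fun n => ENNReal.ofReal M *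
        eLpNorm ((fun x => ‖x - a‖⁻¹ * ψ n x) - fun x => ‖x - a‖⁻¹ * u x) 2) atTop (𝓝 0) := by
      simpa using ENNReal.Tendsto.const_mul hlim (.inr (ENNReal.ofReal_ne_top (r := M)))
    refine tendsto_of_tendsto_of_tendsto_of_le_of_le tendsto_const_nhds h1 (fun _ => zero_le)
      fun n => eLpNorm_le_mul_eLpNorm_of_ae_le_mul ?_ 2
    filter_upwards [hb ((fun x => ‖x - a‖⁻¹ * ψ n x) - fun x => ‖x - a‖⁻¹ * u x)] with x hx
    simpa only [Pi.sub_apply, mul_sub] using hx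
  have hfin := tendsto_integral_inner_of_tendsto_eLpNorm (fun n => hmul (hC _ (hψ n)).1)
    (fun n => (hC _ (hψ n)).1) (hmul hmem) hmem hlim' hlim
  have e : ∀ f : RN N → ℝ, ∀ x, ⟪angular h (x - a) * (‖x - a‖⁻¹ * f x), ‖x - a‖⁻¹ * f x⟫ =
      polePotential h a x * f x ^ 2 := by
    intro f x
    rw [polePotential]
    rw [real_inner_eq_re_inner, RCLike.inner_apply, conj_trivial, RCLike.re_to_real, div_eq_mul_inv, ← inv_pow]
    ring
  simpa only [e] using hfin

end HardyLimit

/-! ### Positivity of the infimum -/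

theorem propositionp (N : ℕ) [Fact (3 ≤ N)] (k : ℕ)
    (h : Fin k → Sph N → ℝ) (hh : ∀ i, SphereContDiff 1 (h i))
    (a : Fin k → RN N) (ha : Function.Injective a)
    (hμ : ∀ i, sphereFirstEigenvalue (h i) > -((((N : ℝ) - 2) / 2) ^ 2))
    (hμsum : sphereFirstEigenvalue (fun θ => ∑ i, h i θ) > -((((N : ℝ) - 2) / 2) ^ 2))
    (hsol : ∃ u : RN N → ℝ, IsPositiveD12Solution h a u) :
    formInf h a > 0 := by
  obtain ⟨v, hv⟩ := hsol
  have hhc : ∀ i, Continuous (h i) := fun i => (hh i).continuous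
  obtain ⟨c, hc, hcoer⟩ := exists_coercive_test hhc ha hμ hμsum hv
  have := nontrivial_RN N
  -- The solution itself shows that the infimum runs over a nonempty set; for an empty set `sInf`
  -- would be `0`.
  have hne : ¬ v =ᵐ[volume] 0 := by
    intro h0
    have h1 : ∀ᵐ _ : RN N, False := by
      filter_upwards [h0, hv.1] with x hx1 hx2
      rw [hx1] at hx2
      exact lt_irrefl _ hx2
    exact (NeZero.ne (volume : Measure (RN N))) (by simp [ae_iff] at h1)
  refine hc.trans_le (le_csInf ?_ ?_)
  · obtain ⟨G, hG, -⟩ := hv.2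
    exact ⟨_, v, G, hG, hne, rfl⟩
  rintro t ⟨u, G, huG, hu0, rfl⟩
  -- A vanishing denominator would turn the quotient into the default value `0`; Sobolev's
  -- inequality rules it out.
  have hpos : 0 < ∫ x, ‖G x‖ ^ 2 :=
    lt_of_le_of_ne (integral_nonneg fun x => sq_nonneg _) fun h0 => hu0 (huG.ae_eq_zero h0.symm)
  rw [le_div_iff₀ hpos]
  obtain ⟨ψ₀, hψ₀, hψ₀u, hψ₀G⟩ := huG.exists_seq_test (Set.finite_range a)
  obtain ⟨ns, hns, hae⟩ := (tendstoInMeasure_of_tendsto_eLpNorm (ofReal_critExp_ne_zero N)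
    (fun n => (hψ₀ n).contDiff.continuous.aestronglyMeasurable) huG.1.1
    hψ₀u).exists_seq_tendsto_ae
  have hψ : ∀ n, IsTestFunction (Set.range a) (ψ₀ (ns n)) := fun n => hψ₀ (ns n)
  have hψG := hψ₀G.comp hns.tendsto_atTop
  have hD : Tendsto (fun n => ∫ x, ‖gradient (ψ₀ (ns n)) x‖ ^ 2) atTop (𝓝 (∫ x, ‖G x‖ ^ 2)) := by
    have hgm : ∀ n, MemLp (gradient (ψ₀ (ns n))) 2 := fun n =>
      memLp_gradient ((hψ n).contDiff.of_le (by simp)) (hψ n).hasCompactSupport 2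
    have := tendsto_integral_inner_of_tendsto_eLpNorm hgm hgm huG.2.1 huG.2.1 hψG hψG
    simpa only [real_inner_self_eq_norm_sq] using this
  have hP : ∀ i, Tendsto (fun n => ∫ x, polePotential (h i) (a i) x * ψ₀ (ns n) x ^ 2) atTop
      (𝓝 (∫ x, polePotential (h i) (a i) x * u x ^ 2)) := fun i =>
    tendsto_integral_polePotential (hhc i) (fun n => (hψ n).mono (by simp)) huG.2.1 huG.1.1 hae hψG
  exact le_of_tendsto_of_tendsto' (hD.const_mul c)
    (hD.sub (tendsto_finsetSum Finset.univ fun i _ => hP i)) fun n => hcoer _ (hψ n)
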